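/- **Theorem.** Let $\Omega=(0,L_1)\times(0,L_2)$ with $L_1,L_2>0$, let $0<\epsilon<1$, $3\le k\le 6$, $N\in\mathbb N$ and $\tau>0$. Let the BDF-$k$ kernels $b^{(k)}_j$ be defined by $\sum_{\ell=1}^{k}\frac1\ell(1-\zeta)^{\ell-1}=\sum_{\ell=0}^{k-1}b^{(k)}_\ell\zeta^\ell$ and $b^{(k)}_j=0$ for $j\ge k$, and put $D_kv^n=\frac1\tau\sum_{j=1}^{n}b^{(k)}_{n-j}(v^j-v^{j-1})$. Consider the BDF-$k$ scheme for the phase field crystal model, with $\Omega$-periodic boundary conditions, $$D_k\phi^n=\Delta\mu^n,\qquad \mu^n=(1+\Delta)^2\phi^n+(\phi^n)^3-\epsilon\phi^n,\qquad k\le n\le N.$$ Assume that $\tau\le\frac{2}{3\epsilon}\,b_0^{(k)}$. Then the scheme is uniquely solvable: 1. at each time level $k\le n\le N$, for all previous values $\phi^0,\dots,\phi^{n-1}\in L^2(\Omega)$ there is exactly one $\phi^n\in L^2(\Omega)$ that satisfies the equation at level $n$; 2. consequently, for all starting values $\phi^0,\dots,\phi^{k-1}\in L^2(\Omega)$ there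 is exactly one sequence $\phi^k,\dots,\phi^N$ in $L^2(\Omega)$ that satisfies the scheme at all levels $k\le n\le N$. Here existence holds in the strong sense: $\Delta\phi^n$, $\Delta^2\phi^n$, $(\phi^n)^3$, $\mu^n$ and $\Delta\mu^n$ are functions in $L^2(\Omega)$, where $w=\Delta v$ means $\int_\Omega v\,\Delta\psi\,dx=\int_\Omega w\,\psi\,dx$ for all smooth $\Omega$-periodic $\psi:\mathbb R^2\to\mathbb R$. Uniqueness holds in the larger class of all $\phi^n\in L^2(\Omega)$ for which $(\phi^n)^3$ is integrable over $\Omega$ and the equation is satisfied in the sense of periodic distributions, that is, $$\int_\Omega (D_k\phi^n)\,\psi\,dx=\int_\Omega\phi^n\,(1+\Delta)^2\Delta\psi\,dx+\int_\Omega\big((\phi^n)^3-\epsilon\phi^n\big)\Delta\psi\,dx$$ for all smooth $\Omega$-periodic $\psi$. -/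

import Mathlib

open MeasureTheory Laplacian
open scoped ContDiff

noncomputable section

namespace PFC

/-- The BDF-`k` kernels `b_j^{(k)}`: the coefficients of the generating polynomial
`∑_{ℓ=1}^{k} (1/ℓ) (1 - ζ)^(ℓ-1)`. They vanish for `j ≥ k`. -/
def bdfKernel (k j : ℕ) : ℝ :=
  (∑ l ∈ Finset.Icc 1 k,
    Polynomial.C ((1 : ℝ) / (l : ℝ)) * (1 - Polynomial.X) ^ (l - 1)).coeff j

/-- The BDF-`k` difference quotient
`D_k v^n = (1/τ) ∑_{j=1}^{n} b_{n-j}^{(k)} (v^j - v^{j-1})` of a sequence in a real vector space. -/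
def bdf {V : Type*} [AddCommGroup V] [Module ℝ V] (k : ℕ) (τ : ℝ) (v : ℕ → V) (n : ℕ) : V :=
  (1 / τ) • ∑ j ∈ Finset.Icc 1 n, bdfKernel k (n - j) • (v j - v (j - 1))

/-- The plane `ℝ²`, with its Euclidean structure. -/
abbrev Plane : Type := EuclideanSpace ℝ (Fin 2)

/-- The period cell `Ω = (0, L 0) × (0, L 1)`. -/
def cell (L : Fin 2 → ℝ) : Set Plane := {x | ∀ i, x i ∈ Set.Ioo 0 (L i)}

/-- The real Hilbert space `L²(Ω)`. Its elements are regarded as `Ω`-periodic functions; the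
periodic boundary conditions enter through the periodic test functions below. -/
abbrev L2 (L : Fin 2 → ℝ) : Type := Lp ℝ 2 (volume.restrict (cell L))

/-- Smooth functions on the plane which are `Ω`-periodic. -/
structure IsTest (L : Fin 2 → ℝ) (ψ : Plane → ℝ) : Prop where
  smooth : ContDiff ℝ ∞ ψ
  periodic : ∀ (i : Fin 2) (x : Plane), ψ (x + EuclideanSpace.single i (L i)) = ψ x

/-- `w = Δ v` in the sense of periodic distributions, both functions being in `L²(Ω)`. -/
def IsLaplacian (L : Fin 2 → ℝ) (v w : L2 L) : Prop :=
  ∀ ψ : Plane → ℝ, IsTest L ψ → ∫ x in cell L, v x * (Δ ψ) x = ∫ x in cell L, w x * ψ x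

/-- `μ = (1 + Δ)² u + u³ - ε u`, all terms being in `L²(Ω)`. -/
def IsChemicalPotential (L : Fin 2 → ℝ) (ε : ℝ) (u μ : L2 L) : Prop :=
  -- `v = (1 + Δ) u`, `w = (1 + Δ) v` and `c = u³`
  ∃ v w c : L2 L, IsLaplacian L u (v - u) ∧ IsLaplacian L v (w - v) ∧
    (∀ᵐ x ∂(volume.restrict (cell L)), c x = u x ^ 3) ∧ μ = w + c - ε • u

/-- The sequence `φ` satisfies the BDF-`k` equation
`D_k φ^n = Δ μ^n`, `μ^n = (1 + Δ)² φ^n + (φ^n)³ - ε φ^n`, with periodic boundary conditions at the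
time level `n`, all the terms being functions in `L²(Ω)`. -/
def SolvesAt (L : Fin 2 → ℝ) (ε : ℝ) (k : ℕ) (τ : ℝ) (φ : ℕ → L2 L) (n : ℕ) : Prop :=
  ∃ μ : L2 L, IsChemicalPotential L ε (φ n) μ ∧ IsLaplacian L μ (bdf k τ φ n)

/-- The sequence `φ` satisfies the same equation at the time level `n` merely in the sense of
periodic distributions: no derivative of `φ^n` needs to be a function, and of `(φ^n)³` only
integrability is asked (so that the equation makes sense). Testing the equations behind `SolvesAt`
with `ψ` and its iterated Laplacians shows that `SolvesAt` implies `SolvesWeaklyAt`. -/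
def SolvesWeaklyAt (L : Fin 2 → ℝ) (ε : ℝ) (k : ℕ) (τ : ℝ) (φ : ℕ → L2 L) (n : ℕ) : Prop :=
  IntegrableOn (fun x => φ n x ^ 3) (cell L) ∧
  ∀ ψ : Plane → ℝ, IsTest L ψ →
    ∫ x in cell L, bdf k τ φ n x * ψ x =
      (∫ x in cell L, φ n x * ((Δ ψ) x + 2 * (Δ (Δ ψ)) x + (Δ (Δ (Δ ψ))) x)) +
      ∫ x in cell L, (φ n x ^ 3 - ε * φ n x) * (Δ ψ) x

end PFC

end

/-! At one time level only the newest BDF term contains the unknown `z`, so the equation reads `a z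
+ q = Δ((1 + Δ)² z + z³ - ε z)` with `a = b₀/τ ≥ 3ε/2` and `q` known. Expand in real plane waves,
which are uniformly bounded. The mean of `z` is fixed by `q`. For an eigenvalue `l > 0` of `-Δ`,
division by `l` leaves the symbol `a/l + (1 - l)² - ε`, which the step restriction bounds below by a
multiple of `(1 + l)²` (`PFC.le_symbol`). Hence the equation is `z = z₀ + S (h - z³)` with a
multiplier `S ≥ 0` that is trace class, because `∑ (1 + l)⁻²` converges in dimension two.

Existence (`HilbertBasis.exists_cubic_solution`): put `T = √S` and `z = z₀ + T w`. With the cube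
truncated at height `R`, the equation for `w` is Lipschitz and strongly monotone, hence solvable.
Monotonicity bounds `‖w‖` independently of `R`. Since `√s` and the coefficients of `w` are square
summable, those of `z` are absolutely summable, so `z` is bounded independently of `R`, and for
suitable `R` the truncation is inactive.

Uniqueness (`HilbertBasis.cubic_solution_unique`): an integrable cube has bounded coefficients, so
the trace class property makes every weak solution bounded. Then `z - z' = -S (z³ - z'³)`, and
testing with `z³ - z'³` sets monotonicity of the cube against `S ≥ 0`.

The decay of `S` also puts `(1 + Δ) z` and `(1 + Δ)² z` in `L²`, so the solution is strong. -/

/-! ### Monotone operators and multipliers in Hilbert space -/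

/-- A Lipschitz, strongly monotone operator on a real Hilbert space has a zero. -/
theorem exists_zero_of_lipschitz_of_stronglyMonotone {H : Type*} [NormedAddCommGroup H]
    [InnerProductSpace ℝ H] [CompleteSpace H] (F : H → H) (K : ℝ)
    (hK : ∀ x y, ‖F x - F y‖ ≤ K * ‖x - y‖)
    (hF : ∀ x y, ‖x - y‖ ^ 2 ≤ inner ℝ (F x - F y) (x - y)) : ∃ x, F x = 0 := by
  set C : ℝ := |K| + 1 with hC
  have hC1 : 1 ≤ C := by simp [hC]
  have hCpos : 0 < C := by linarith
  set q : ℝ := 1 - (C ^ 2)⁻¹ with hq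
  have hinv : 0 < (C ^ 2)⁻¹ := by positivity
  have hinv1 : (C ^ 2)⁻¹ ≤ 1 := inv_le_one_of_one_le₀ (one_le_pow₀ hC1)
  have hq0 : 0 ≤ q := by linarith
  have hq1 : q < 1 := by linarith
  -- Damped iteration with step `C⁻²`: expanding the square gives the factor `1 - 2 C⁻² + C⁻² = q`.
  -- Taking `C ≥ 1` ensures `q ≥ 0`.
  set Φ : H → H := fun x => x - (C ^ 2)⁻¹ • F x with hΦ
  have key : ∀ x y, ‖Φ x - Φ y‖ ≤ Real.sqrt q * ‖x - y‖ := by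
    intro x y
    have e : Φ x - Φ y = (x - y) - (C ^ 2)⁻¹ • (F x - F y) := by
      simp only [hΦ, smul_sub]; abel
    have h1 : ‖F x - F y‖ ≤ C * ‖x - y‖ := (hK x y).trans <| by
      gcongr; linarith [le_abs_self K]
    have h2 : ‖F x - F y‖ ^ 2 ≤ C ^ 2 * ‖x - y‖ ^ 2 := by
      rw [← mul_pow]; gcongr
    have h3 : ‖Φ x - Φ y‖ ^ 2 ≤ q * ‖x - y‖ ^ 2 := by
      rw [e, norm_sub_sq_real, norm_smul, real_inner_smul_right, real_inner_comm,
        Real.norm_of_nonneg hinv.le, mul_pow]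
      have h4 : ((C ^ 2)⁻¹) ^ 2 * ‖F x - F y‖ ^ 2 ≤ (C ^ 2)⁻¹ * ‖x - y‖ ^ 2 := by
        calc ((C ^ 2)⁻¹) ^ 2 * ‖F x - F y‖ ^ 2
            ≤ ((C ^ 2)⁻¹) ^ 2 * (C ^ 2 * ‖x - y‖ ^ 2) := by gcongr
          _ = _ := by field_simp
      have h5 := mul_le_mul_of_nonneg_left (hF x y) hinv.le
      rw [hq]; nlinarith
    calc ‖Φ x - Φ y‖ = Real.sqrt (‖Φ x - Φ y‖ ^ 2) := (Real.sqrt_sq (norm_nonneg _)).symm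
      _ ≤ Real.sqrt (q * ‖x - y‖ ^ 2) := Real.sqrt_le_sqrt h3
      _ = _ := by rw [Real.sqrt_mul hq0, Real.sqrt_sq (norm_nonneg _)]
  have hcw : ContractingWith ⟨Real.sqrt q, Real.sqrt_nonneg q⟩ Φ := by
    refine ⟨NNReal.coe_lt_coe.1 ((Real.sqrt_lt_sqrt hq0 hq1).trans_eq Real.sqrt_one),
      LipschitzWith.of_dist_le_mul fun x y => ?_⟩
    rw [dist_eq_norm, dist_eq_norm]; exact key x y
  have hfix : Φ (hcw.fixedPoint Φ) = hcw.fixedPoint Φ := hcw.fixedPoint_isFixedPt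
  refine ⟨hcw.fixedPoint Φ, ?_⟩
  have : (C ^ 2)⁻¹ • F (hcw.fixedPoint Φ) = 0 := sub_eq_self.mp hfix
  exact (smul_eq_zero.mp this).resolve_left hinv.ne'

/-- A bounded multiplier in a Hilbert basis. -/
theorem HilbertBasis.exists_multiplier {ι H : Type*} [NormedAddCommGroup H]
    [InnerProductSpace ℝ H] (b : HilbertBasis ι ℝ H) (t : ι → ℝ) (C : ℝ)
    (ht : ∀ i, |t i| ≤ C) (x : H) : ∃ y : H, ∀ i, inner ℝ (b i) y = t i * inner ℝ (b i) x := by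
  have hmem : Memℓp (fun i => t i * b.repr x i) 2 := by
    refine Memℓp.mono (g := fun i => C * ‖b.repr x i‖) ?_ fun i => ?_
    · exact (memℓp_gen_iff (by simp)).2 <| by
        simpa [mul_pow] using ((lp.memℓp (b.repr x)).summable (by simp)).mul_left (C ^ 2)
    · rw [norm_mul]
      exact mul_le_mul_of_nonneg_right (ht i) (norm_nonneg _)
  refine ⟨b.repr.symm ⟨_, hmem⟩, fun i => ?_⟩
  rw [← b.repr_apply_apply, ← b.repr_apply_apply, LinearIsometryEquiv.apply_symm_apply]

theorem HilbertBasis.ext_inner {ι H : Type*} [NormedAddCommGroup H]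
    [InnerProductSpace ℝ H] (b : HilbertBasis ι ℝ H) {x y : H}
    (h : ∀ i, inner ℝ (b i) x = inner ℝ (b i) y) : x = y := by
  apply b.repr.injective
  ext i
  rw [b.repr_apply_apply, b.repr_apply_apply, h i]

/-- In a Banach lattice, the absolute value of an unconditionally convergent sum is dominated. -/
theorem abs_le_of_hasSum {μ' : Type*} [MeasurableSpace μ'] {μ : Measure μ'} {ι : Type*}
    {f g : ι → Lp ℝ 2 μ} {z s : Lp ℝ 2 μ} (hf : HasSum f z) (hg : HasSum g s)
    (h : ∀ i, |f i| ≤ g i) : |z| ≤ s :=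
  abs_le'.2 ⟨hasSum_le (fun i => (le_abs_self _).trans (h i)) hf hg,
    hasSum_le (fun i => (neg_le_abs _).trans (h i)) hf.neg hg⟩

/-- Parseval makes the multiplier symmetric, and an everywhere defined symmetric operator is
continuous (Hellinger–Toeplitz). It serves to form the square root of `S`. -/
theorem HilbertBasis.exists_multiplierCLM {ι H : Type*} [NormedAddCommGroup H]
    [InnerProductSpace ℝ H] [CompleteSpace H] (b : HilbertBasis ι ℝ H) (t : ι → ℝ) (C : ℝ)
    (ht : ∀ i, |t i| ≤ C) : ∃ T : H →L[ℝ] H, (∀ x i, inner ℝ (b i) (T x) = t i * inner ℝ (b i) x) ∧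
      ∀ x y, inner ℝ (T x) y = inner ℝ x (T y) := by
  choose T hT using b.exists_multiplier t C ht
  let T' : H →ₗ[ℝ] H :=
    { toFun := T
      map_add' := fun x y => b.ext_inner fun i => by simp only [hT, inner_add_right, mul_add]
      map_smul' := fun r x => b.ext_inner fun i => by
        simp only [hT, real_inner_smul_right, RingHom.id_apply]; ring }
  have hsymm : ∀ x y, inner ℝ (T x) y = inner ℝ x (T y) := fun x y => by
    rw [← b.tsum_inner_mul_inner (T x) y, ← b.tsum_inner_mul_inner x (T y)]
    refine tsum_congr fun i => ?_
    rw [real_inner_comm, hT, hT, real_inner_comm x]; ring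
  exact ⟨⟨T', LinearMap.IsSymmetric.continuous (T := T') hsymm⟩, hT, hsymm⟩

/-! ### The truncated cube -/

/-- The cube, truncated at height `R`. -/
def clampCube (R s : ℝ) : ℝ := (max (-R) (min R s)) ^ 3

theorem clampCube_of_abs_le {R s : ℝ} (h : |s| ≤ R) : clampCube R s = s ^ 3 := by
  rw [abs_le] at h
  rw [clampCube, min_eq_right h.2, max_eq_right h.1]

theorem clampCube_zero {R : ℝ} (hR : 0 ≤ R) : clampCube R 0 = 0 := by
  rw [clampCube_of_abs_le (by simpa using hR)]; simp

theorem clampCube_monotone (R : ℝ) : Monotone (clampCube R) := fun s t hst =>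
  (Odd.strictMono_pow (by decide : Odd 3)).monotone (max_le_max le_rfl (min_le_min le_rfl hst))

theorem clampCube_lipschitz {R : ℝ} (hR : 0 ≤ R) :
    LipschitzWith (3 * R ^ 2).toNNReal (clampCube R) := by
  refine LipschitzWith.of_dist_le_mul fun s t => ?_
  rw [Real.coe_toNNReal _ (by positivity), Real.dist_eq, Real.dist_eq]
  set p := max (-R) (min R s) with hp
  set q := max (-R) (min R t) with hq
  have hpR : |p| ≤ R := abs_le.2 ⟨le_max_left _ _, max_le (by linarith) (min_le_left _ _)⟩
  have hqR : |q| ≤ R := abs_le.2 ⟨le_max_left _ _, max_le (by linarith) (min_le_left _ _)⟩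
  have hpq : |p - q| ≤ |s - t| :=
    (abs_max_sub_max_le_max _ _ _ _).trans <| max_le (by simp) <|
      (abs_min_sub_min_le_max _ _ _ _).trans <| max_le (by simp) le_rfl
  have h1 : |p ^ 2 + p * q + q ^ 2| ≤ 3 * R ^ 2 := by
    rw [abs_le] at hpR hqR ⊢
    constructor <;> nlinarith
  change |p ^ 3 - q ^ 3| ≤ _
  rw [show p ^ 3 - q ^ 3 = (p ^ 2 + p * q + q ^ 2) * (p - q) by ring, abs_mul]
  gcongr

/-! ### The cubic equation with a trace class multiplier -/

section CubicEquation

variable {α : Type*} [MeasurableSpace α] {μ : Measure α} {ι : Type*}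

theorem inner_nonneg_of_ae {f g : Lp ℝ 2 μ} (h : ∀ᵐ x ∂μ, 0 ≤ f x * g x) :
    0 ≤ inner ℝ f g := by
  rw [L2.inner_def]
  refine integral_nonneg_of_ae ?_
  filter_upwards [h] with x hx
  simpa [mul_comm] using hx

/-- A function with absolutely summable coefficients in a uniformly bounded Hilbert basis is
bounded. -/
theorem HilbertBasis.ae_abs_le [IsFiniteMeasure μ] (b : HilbertBasis ι ℝ (Lp ℝ 2 μ)) {C : ℝ}
    (hb : ∀ i, ∀ᵐ x ∂μ, |b i x| ≤ C) {z : Lp ℝ 2 μ}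
    (hz : Summable fun i => |inner ℝ (b i) z|) :
    ∀ᵐ x ∂μ, |z x| ≤ (∑' i, |inner ℝ (b i) z|) * C := by
  have h1 : HasSum (fun i => inner ℝ (b i) z • b i) z := by
    simpa only [b.repr_apply_apply] using b.hasSum_repr z
  have h2 := hz.hasSum.smul_const (Lp.const 2 μ C)
  have h3 := abs_le_of_hasSum h1 h2 fun i => by
    rw [← Lp.coeFn_le]
    filter_upwards [hb i, Lp.coeFn_abs (inner ℝ (b i) z • b i),
      Lp.coeFn_const (p := 2) (μ := μ) (c := C), Lp.coeFn_smul (inner ℝ (b i) z) (b i),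
      Lp.coeFn_smul |inner ℝ (b i) z| (Lp.const 2 μ C)] with x h4 h5 h6 h7 h8
    rw [h5, h7, h8, Pi.smul_apply, Pi.smul_apply, h6, smul_eq_mul, abs_mul]
    exact mul_le_mul_of_nonneg_left h4 (abs_nonneg _)
  rw [← Lp.coeFn_le] at h3
  filter_upwards [h3, Lp.coeFn_abs z, Lp.coeFn_const (p := 2) (μ := μ) (c := C),
    Lp.coeFn_smul (∑' i, |inner ℝ (b i) z|) (Lp.const 2 μ C)] with x h4 h5 h6 h7
  rw [h5, h7, Pi.smul_apply, h6] at h4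
  exact h4

/-- Existence for the equation `z = z₀ + S (h - z³)`, where `S` is a nonnegative trace class
multiplier in a uniformly bounded Hilbert basis of `L²`. -/
theorem HilbertBasis.exists_cubic_solution [IsFiniteMeasure μ]
    (b : HilbertBasis ι ℝ (Lp ℝ 2 μ)) {C : ℝ} (hC : 0 ≤ C)
    (hb : ∀ i, ∀ᵐ x ∂μ, |b i x| ≤ C) {s : ι → ℝ} (hs0 : ∀ i, 0 ≤ s i) (hs : Summable s)
    (z₀ h : Lp ℝ 2 μ) (hz₀ : Summable fun i => |inner ℝ (b i) z₀|) :
    ∃ z c : Lp ℝ 2 μ, (∀ᵐ x ∂μ, c x = z x ^ 3) ∧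
      ∀ i, inner ℝ (b i) z = inner ℝ (b i) z₀ + s i * (inner ℝ (b i) h - inner ℝ (b i) c) := by
  obtain ⟨T, hT, hTs⟩ := b.exists_multiplierCLM (fun i => Real.sqrt (s i))
    (Real.sqrt (∑' i, s i)) fun i => by
      rw [abs_of_nonneg (Real.sqrt_nonneg _)]
      exact Real.sqrt_le_sqrt (hs.le_tsum i fun j _ => hs0 j)
  set A : ℝ := ∑' i, |inner ℝ (b i) z₀| with hA
  have hA0 : 0 ≤ A := tsum_nonneg fun i => abs_nonneg _
  set S : ℝ := ∑' i, s i with hS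
  have hS0 : 0 ≤ S := tsum_nonneg hs0
  have hAC : 0 ≤ A * C := mul_nonneg hA0 hC
  -- This is the cube of `z₀`, since `|z₀| ≤ A * C`. Truncating at that height rather than at `R`
  -- keeps `M` independent of `R`, which is defined from `M`.
  set c₀ : Lp ℝ 2 μ := (clampCube_lipschitz hAC).compLp (clampCube_zero hAC) z₀ with hc₀
  set M : ℝ := ‖T c₀ - T h‖ with hM
  set R : ℝ := (A + (S + M ^ 2)) * C with hR
  have hAR : A * C ≤ R := by
    rw [hR]; gcongr; nlinarith [sq_nonneg M]
  have hR0 : 0 ≤ R := hAC.trans hAR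
  set B : Lp ℝ 2 μ → Lp ℝ 2 μ := (clampCube_lipschitz hR0).compLp (clampCube_zero hR0) with hB
  have hBae : ∀ u, ∀ᵐ x ∂μ, B u x = clampCube R (u x) := fun u =>
    (clampCube_lipschitz hR0).coeFn_compLp (clampCube_zero hR0) u
  have hBlip : ∀ u v, ‖B u - B v‖ ≤ 3 * R ^ 2 * ‖u - v‖ := fun u v => by
    have := (clampCube_lipschitz hR0).norm_compLp_sub_le (clampCube_zero hR0) u v
    rwa [Real.coe_toNNReal _ (by positivity)] at this
  have hBmono : ∀ u v, 0 ≤ inner ℝ (B u - B v) (u - v) := fun u v => by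
    refine inner_nonneg_of_ae ?_
    filter_upwards [hBae u, hBae v, Lp.coeFn_sub (B u) (B v), Lp.coeFn_sub u v]
      with x h1 h2 h3 h4
    rw [h3, h4, Pi.sub_apply, Pi.sub_apply, h1, h2]
    rcases le_total (u x) (v x) with h5 | h5
    · exact mul_nonneg_of_nonpos_of_nonpos (sub_nonpos.2 (clampCube_monotone R h5))
        (sub_nonpos.2 h5)
    · exact mul_nonneg (sub_nonneg.2 (clampCube_monotone R h5)) (sub_nonneg.2 h5)
  -- The symmetric form of the equation: one factor `T` stands on either side of the monotone map
  -- `B`, so by symmetry of `T` the nonlinear term is monotone in `w`.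
  set F : Lp ℝ 2 μ → Lp ℝ 2 μ := fun w => w + T (B (z₀ + T w)) - T h with hF
  have hFsub : ∀ w v, F w - F v = (w - v) + T (B (z₀ + T w) - B (z₀ + T v)) := fun w v => by
    simp only [hF, map_sub]; abel
  have hFmono : ∀ w v, ‖w - v‖ ^ 2 ≤ inner ℝ (F w - F v) (w - v) := fun w v => by
    rw [hFsub, inner_add_left, real_inner_self_eq_norm_sq, hTs, map_sub]
    have := hBmono (z₀ + T w) (z₀ + T v)
    rw [add_sub_add_left_eq_sub] at this
    linarith
  have hFlip : ∀ w v, ‖F w - F v‖ ≤ (1 + ‖T‖ * (3 * R ^ 2 * ‖T‖)) * ‖w - v‖ := fun w v => by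
    have h1 := hBlip (z₀ + T w) (z₀ + T v)
    rw [add_sub_add_left_eq_sub, ← map_sub] at h1
    rw [hFsub]
    calc _ ≤ ‖w - v‖ + ‖T (B (z₀ + T w) - B (z₀ + T v))‖ := norm_add_le _ _
      _ ≤ ‖w - v‖ + ‖T‖ * (3 * R ^ 2 * (‖T‖ * ‖w - v‖)) := by
        gcongr
        refine (T.le_opNorm _).trans ?_
        gcongr
        refine h1.trans ?_
        gcongr
        exact T.le_opNorm _
      _ = _ := by ring
  obtain ⟨w, hw⟩ := exists_zero_of_lipschitz_of_stronglyMonotone F _ hFlip hFmono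
  have hB₀ : B z₀ = c₀ := by
    refine Lp.ext ?_
    filter_upwards [hBae z₀, b.ae_abs_le hb hz₀,
      (clampCube_lipschitz hAC).coeFn_compLp (clampCube_zero hAC) z₀] with x h1 h2 h3
    rw [h1, hc₀, h3, Function.comp_apply, clampCube_of_abs_le h2,
      clampCube_of_abs_le (h2.trans hAR)]
  have hF0 : ‖F 0‖ = M := by simp [hF, hB₀, hM]
  -- Strong monotonicity between `w` and `0` gives `‖w‖² ≤ -⟪F 0, w⟫ ≤ M ‖w‖`.
  have hwM : ‖w‖ ≤ M := by
    have h1 := hFmono w 0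
    rw [hw, zero_sub, sub_zero, inner_neg_left] at h1
    have h2 := abs_real_inner_le_norm (F 0) w
    rw [hF0] at h2
    have h3 := neg_abs_le (inner ℝ (F 0) w)
    by_contra! h4
    have h5 : 0 ≤ M := norm_nonneg _
    nlinarith [mul_pos (h5.trans_lt h4) (sub_pos.2 h4)]
  have hwsum : HasSum (fun i => inner ℝ (b i) w ^ 2) (‖w‖ ^ 2) := by
    have := b.hasSum_inner_mul_inner w w
    rw [real_inner_self_eq_norm_sq] at this
    convert! this using 2 with i
    rw [real_inner_comm w, sq]
  -- Young's inequality for `√(s i)` times the coefficient of `w`. The sum of the right-hand sides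
  -- is at most `A + S + M²`, whence the choice of `R`.
  have hle : ∀ i, |inner ℝ (b i) (z₀ + T w)| ≤
      |inner ℝ (b i) z₀| + (s i + inner ℝ (b i) w ^ 2) := fun i => by
    rw [inner_add_right, hT]
    refine (abs_add_le _ _).trans ?_
    gcongr
    rw [abs_le]
    have h1 := Real.sq_sqrt (hs0 i)
    constructor <;> nlinarith [sq_nonneg (Real.sqrt (s i) + inner ℝ (b i) w),
      sq_nonneg (Real.sqrt (s i) - inner ℝ (b i) w)]
  have hsum := hz₀.hasSum.add (hs.hasSum.add hwsum)
  have hzsum : Summable fun i => |inner ℝ (b i) (z₀ + T w)| :=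
    hsum.summable.of_nonneg_of_le (fun i => abs_nonneg _) hle
  have hzR : ∀ᵐ x ∂μ, |(z₀ + T w : Lp ℝ 2 μ) x| ≤ R := by
    filter_upwards [b.ae_abs_le hb hzsum] with x hx
    refine hx.trans ?_
    rw [hR]
    gcongr
    refine (hasSum_le hle hzsum.hasSum hsum).trans ?_
    gcongr
  refine ⟨z₀ + T w, B (z₀ + T w), ?_, fun i => ?_⟩
  · filter_upwards [hBae (z₀ + T w), hzR] with x h1 h2
    rw [h1, clampCube_of_abs_le h2]
  · have h1 : w = T (h - B (z₀ + T w)) := by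
      rw [map_sub, eq_sub_iff_add_eq, ← sub_eq_zero]; exact hw
    rw [inner_add_right, hT]
    conv_lhs => rw [h1]
    rw [hT, ← mul_assoc, Real.mul_self_sqrt (hs0 i), inner_sub_right]

/-- A solution of `z = z₀ + S (h - z³)` with integrable cube is bounded. -/
theorem HilbertBasis.exists_bound_of_cubic_solution [IsFiniteMeasure μ]
    (b : HilbertBasis ι ℝ (Lp ℝ 2 μ)) {C : ℝ}
    (hb : ∀ i, ∀ᵐ x ∂μ, |b i x| ≤ C) {s : ι → ℝ} (hs0 : ∀ i, 0 ≤ s i) (hs : Summable s)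
    {z₀ h z : Lp ℝ 2 μ} (hz₀ : Summable fun i => |inner ℝ (b i) z₀|)
    (hz3 : Integrable (fun x => z x ^ 3) μ)
    (hz : ∀ i, inner ℝ (b i) z =
      inner ℝ (b i) z₀ + s i * (inner ℝ (b i) h - ∫ x, z x ^ 3 * b i x ∂μ)) :
    ∃ K, ∀ᵐ x ∂μ, |z x| ≤ K := by
  refine ⟨_, b.ae_abs_le hb ?_⟩
  -- `J` bounds every coefficient of the cube, since the basis functions are bounded by `C`.
  set J : ℝ := ∫ x, |z x ^ 3| * C ∂μ with hJ
  refine (hz₀.add (hs.mul_right (‖h‖ + J))).of_nonneg_of_le (fun i => abs_nonneg _) fun i => ?_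
  rw [hz i]
  refine (abs_add_le _ _).trans ?_
  rw [abs_mul, abs_of_nonneg (hs0 i)]
  have h1 : |inner ℝ (b i) h| ≤ ‖h‖ := by
    have := abs_real_inner_le_norm (b i) h
    rwa [b.orthonormal.1 i, one_mul] at this
  have h2 : |∫ x, z x ^ 3 * b i x ∂μ| ≤ J := by
    rw [← Real.norm_eq_abs]
    refine norm_integral_le_of_norm_le (hz3.abs.mul_const C) ?_
    filter_upwards [hb i] with x hx
    rw [norm_mul, Real.norm_eq_abs, Real.norm_eq_abs]
    gcongr
  gcongr
  · exact hs0 i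
  · exact (abs_sub _ _).trans (add_le_add h1 h2)

theorem exists_cube_of_ae_abs_le [IsFiniteMeasure μ] {z : Lp ℝ 2 μ} {K : ℝ}
    (hK : ∀ᵐ x ∂μ, |z x| ≤ K) : ∃ c : Lp ℝ 2 μ, ∀ᵐ x ∂μ, c x = z x ^ 3 := by
  have : MemLp (fun x => z x ^ 3) 2 μ := by
    refine MemLp.of_bound ((Lp.aestronglyMeasurable z).pow 3) (K ^ 3) ?_
    filter_upwards [hK] with x hx
    rw [norm_pow, Real.norm_eq_abs]
    gcongr
  exact ⟨this.toLp _, this.coeFn_toLp⟩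

/-- Uniqueness for the equation `z = z₀ + S (h - z³)` among functions with integrable cube. -/
theorem HilbertBasis.cubic_solution_unique [IsFiniteMeasure μ]
    (b : HilbertBasis ι ℝ (Lp ℝ 2 μ)) {C : ℝ}
    (hb : ∀ i, ∀ᵐ x ∂μ, |b i x| ≤ C) {s : ι → ℝ} (hs0 : ∀ i, 0 ≤ s i) (hs : Summable s)
    {z₀ h z z' : Lp ℝ 2 μ} (hz₀ : Summable fun i => |inner ℝ (b i) z₀|)
    (hz3 : Integrable (fun x => z x ^ 3) μ)
    (hz : ∀ i, inner ℝ (b i) z =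
      inner ℝ (b i) z₀ + s i * (inner ℝ (b i) h - ∫ x, z x ^ 3 * b i x ∂μ))
    (hz3' : Integrable (fun x => z' x ^ 3) μ)
    (hz' : ∀ i, inner ℝ (b i) z' =
      inner ℝ (b i) z₀ + s i * (inner ℝ (b i) h - ∫ x, z' x ^ 3 * b i x ∂μ)) :
    z = z' := by
  obtain ⟨K, hK⟩ := b.exists_bound_of_cubic_solution hb hs0 hs hz₀ hz3 hz
  obtain ⟨K', hK'⟩ := b.exists_bound_of_cubic_solution hb hs0 hs hz₀ hz3' hz'
  obtain ⟨c, hc⟩ := exists_cube_of_ae_abs_le hK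
  obtain ⟨c', hc'⟩ := exists_cube_of_ae_abs_le hK'
  have hint : ∀ {u c : Lp ℝ 2 μ}, (∀ᵐ x ∂μ, c x = u x ^ 3) → ∀ i,
      ∫ x, u x ^ 3 * b i x ∂μ = inner ℝ (b i) c := fun {u c} huc i => by
    rw [L2.inner_def]
    refine integral_congr_ae ?_
    filter_upwards [huc] with x hx
    simp [hx]
  have hd : ∀ i, inner ℝ (b i) (z - z') = -(s i * inner ℝ (b i) (c - c')) := fun i => by
    rw [inner_sub_right, hz, hz', hint hc, hint hc', inner_sub_right]; ring
  have hsum := b.hasSum_inner_mul_inner (c - c') (z - z')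
  have hterm : ∀ i, inner ℝ (c - c') (b i) * inner ℝ (b i) (z - z') =
      -(s i * inner ℝ (b i) (c - c') ^ 2) := fun i => by
    rw [hd, real_inner_comm]; ring
  simp only [hterm] at hsum
  have hnn : 0 ≤ inner ℝ (c - c') (z - z') := by
    refine inner_nonneg_of_ae ?_
    filter_upwards [hc, hc', Lp.coeFn_sub c c', Lp.coeFn_sub z z'] with x h1 h2 h3 h4
    rw [h3, h4, Pi.sub_apply, Pi.sub_apply, h1, h2]
    nlinarith [mul_nonneg (sq_nonneg (z x - z' x)) (sq_nonneg (z x + z' x)),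
      mul_nonneg (sq_nonneg (z x - z' x)) (add_nonneg (sq_nonneg (z x)) (sq_nonneg (z' x)))]
  have hneg := hsum.neg
  simp only [neg_neg] at hneg
  have hge : ∀ i, 0 ≤ s i * inner ℝ (b i) (c - c') ^ 2 := fun i =>
    mul_nonneg (hs0 i) (sq_nonneg _)
  refine b.ext_inner fun i => sub_eq_zero.1 ?_
  rw [← inner_sub_right, hd]
  -- A single nonnegative term is at most the full sum, which equals `-⟪c - c', z - z'⟫ ≤ 0`; so
  -- every term vanishes.
  have h0 := le_hasSum hneg i fun j _ => hge j
  have h1 : s i * inner ℝ (b i) (c - c') ^ 2 = 0 := le_antisymm (by linarith) (hge i)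
  rcases mul_eq_zero.1 h1 with h2 | h2
  · simp [h2]
  · simp [pow_eq_zero_iff] at h2; simp [h2]

end CubicEquation

namespace PFC

/-! ### Measure and integration on the period cell -/

theorem isOpen_cell (L : Fin 2 → ℝ) : IsOpen (cell L) := by
  have : cell L = ⋂ i, {x : Plane | x i ∈ Set.Ioo 0 (L i)} := by ext; simp [cell]
  rw [this]
  exact isOpen_iInter_of_finite fun i => isOpen_Ioo.preimage (by fun_prop)

theorem toLp_preimage_cell (L : Fin 2 → ℝ) :
    (WithLp.toLp 2 : (Fin 2 → ℝ) → Plane) ⁻¹' cell L =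
      Set.pi Set.univ fun i => Set.Ioo 0 (L i) := by
  ext x; simp [cell]

theorem cell_subset_image_Icc (L : Fin 2 → ℝ) :
    cell L ⊆ (WithLp.toLp 2 : (Fin 2 → ℝ) → Plane) '' Set.Icc 0 L := fun x hx =>
  ⟨WithLp.ofLp x, ⟨fun i => (hx i).1.le, fun i => (hx i).2.le⟩, rfl⟩

theorem isCompact_image_Icc (L : Fin 2 → ℝ) :
    IsCompact ((WithLp.toLp 2 : (Fin 2 → ℝ) → Plane) '' Set.Icc 0 L) :=
  isCompact_Icc.image (PiLp.continuous_toLp 2 _)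

instance isFiniteMeasure_cell (L : Fin 2 → ℝ) :
    IsFiniteMeasure ((volume : Measure Plane).restrict (cell L)) :=
  ⟨by
    rw [Measure.restrict_apply_univ]
    exact (measure_mono (cell_subset_image_Icc L)).trans_lt (isCompact_image_Icc L).measure_lt_top⟩

theorem volume_real_cell_pos {L : Fin 2 → ℝ} (hL : ∀ i, 0 < L i) :
    0 < (volume : Measure Plane).real (cell L) := by
  refine ENNReal.toReal_pos ((isOpen_cell L).measure_pos volume ?_).ne' ?_
  · exact ⟨WithLp.toLp 2 fun i => L i / 2, fun i =>
      ⟨by have := hL i; simp; linarith, by have := hL i; simp; linarith⟩⟩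
  · have := (isFiniteMeasure_cell L).measure_univ_lt_top
    rw [Measure.restrict_apply_univ] at this
    exact this.ne

theorem setIntegral_cell_eq (L : Fin 2 → ℝ) (g : Plane → ℝ) :
    ∫ x in cell L, g x = ∫ y in Set.Icc 0 L, g (WithLp.toLp 2 y) := by
  rw [← (PiLp.volume_preserving_toLp (Fin 2)).setIntegral_preimage_emb
    (MeasurableEquiv.toLp 2 (Fin 2 → ℝ)).measurableEmbedding, toLp_preimage_cell]
  exact setIntegral_congr_set Measure.univ_pi_Ioo_ae_eq_Icc

theorem memLp_cell_of_continuous (L : Fin 2 → ℝ) {g : Plane → ℝ} (hg : Continuous g)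
    (p : ENNReal) : MemLp g p (volume.restrict (cell L)) := by
  obtain ⟨C, hC⟩ := (isCompact_image_Icc L).exists_bound_of_continuousOn hg.continuousOn
  refine MemLp.of_bound hg.aestronglyMeasurable C ?_
  exact (ae_restrict_mem (isOpen_cell L).measurableSet).mono fun x hx =>
    hC x (cell_subset_image_Icc L hx)

theorem integrableOn_cell_of_continuous (L : Fin 2 → ℝ) {g : Plane → ℝ} (hg : Continuous g) :
    IntegrableOn g (cell L) :=
  memLp_one_iff_integrable.1 (memLp_cell_of_continuous L hg 1)

/-! ### Periodic functions and Green's identity -/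

/-- The partial derivatives of a function on the plane. -/
noncomputable def partialDeriv (i : Fin 2) (f : Plane → ℝ) (x : Plane) : ℝ :=
  fderiv ℝ f x (EuclideanSpace.single i 1)

/-- `Ω`-periodicity. -/
noncomputable def IsPeriodic (L : Fin 2 → ℝ) (f : Plane → ℝ) : Prop :=
  ∀ (i : Fin 2) (x : Plane), f (x + EuclideanSpace.single i (L i)) = f x

theorem IsPeriodic.mul {L : Fin 2 → ℝ} {f g : Plane → ℝ} (hf : IsPeriodic L f)
    (hg : IsPeriodic L g) : IsPeriodic L (fun x => f x * g x) := fun i x => by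
  simp only [hf i x, hg i x]

theorem IsPeriodic.partialDeriv {L : Fin 2 → ℝ} {f : Plane → ℝ} (hf : IsPeriodic L f)
    (i : Fin 2) : IsPeriodic L (partialDeriv i f) := fun j x => by
  have h : (fun y => f (y + EuclideanSpace.single j (L j))) = f := funext (hf j)
  rw [PFC.partialDeriv, PFC.partialDeriv, ← fderiv_comp_add_right, h]

theorem contDiff_partialDeriv {f : Plane → ℝ} {m n : WithTop ℕ∞} (hf : ContDiff ℝ n f)
    (hmn : m + 1 ≤ n) (i : Fin 2) : ContDiff ℝ m (partialDeriv i f) :=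
  (hf.fderiv_right hmn).clm_apply contDiff_const

theorem partialDeriv_mul {f g : Plane → ℝ} (hf : Differentiable ℝ f) (hg : Differentiable ℝ g)
    (i : Fin 2) (x : Plane) : partialDeriv i (fun y => f y * g y) x =
      f x * partialDeriv i g x + g x * partialDeriv i f x := by
  simp only [partialDeriv]
  rw [fderiv_fun_mul (hf x) (hg x)]
  simp

/-- The integral of a derivative of a periodic function over the period cell vanishes. -/
theorem integral_partialDeriv_eq_zero {L : Fin 2 → ℝ} (hL : ∀ i, 0 < L i) {f : Plane → ℝ}
    (hf : ContDiff ℝ 1 f) (hper : IsPeriodic L f) (i : Fin 2) :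
    ∫ x in cell L, partialDeriv i f x = 0 := by
  rw [setIntegral_cell_eq]
  set T : (Fin 2 → ℝ) ≃L[ℝ] Plane := (EuclideanSpace.equiv (Fin 2) ℝ).symm with hT
  have hTv : ∀ y, T y = WithLp.toLp 2 y := fun y => rfl
  have hcont : Continuous (partialDeriv i f) :=
    (contDiff_partialDeriv (m := 0) hf (by simp) i).continuous
  -- The divergence theorem for the field whose `i`-th component is `f` and whose other component is
  -- zero.
  have key := integral_divergence_of_hasFDerivAt_off_countable' (E := ℝ) (n := 1) 0 L
    (fun i => (hL i).le) (fun j y => (if j = i then 1 else 0) * f (T y))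
    (fun j y => (if j = i then (1 : ℝ) else 0) • (fderiv ℝ f (T y)).comp (T : (Fin 2 → ℝ) →L[ℝ] Plane))
    ∅ Set.countable_empty
    (fun j => (continuous_const.mul (hf.continuous.comp T.continuous)).continuousOn)
    (fun y _ j => ((((hf.differentiable one_ne_zero (T y)).hasFDerivAt).comp y
      T.hasFDerivAt).const_mul _))
  have hsum : ∀ y : Fin 2 → ℝ, ∑ j : Fin 2, ((if j = i then (1 : ℝ) else 0) •
      (fderiv ℝ f (T y)).comp (T : (Fin 2 → ℝ) →L[ℝ] Plane)) (Pi.single j 1) =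
      partialDeriv i f (T y) := fun y => by
    simp only [ite_smul, one_smul, zero_smul]
    rw [Finset.sum_eq_single i (fun j _ hj => by simp [hj]) (by simp)]
    simp [partialDeriv, hTv]
  simp only [hsum] at key
  refine (key (((hcont.comp T.continuous).continuousOn).integrableOn_compact isCompact_Icc)).trans ?_
  refine Finset.sum_eq_zero fun j _ => ?_
  rw [sub_eq_zero]
  refine setIntegral_congr_fun measurableSet_Icc fun y _ => ?_
  -- Opposite faces differ by one period, so their contributions cancel.
  have h1 : T (j.insertNth (L j) y) =
      T (j.insertNth ((0 : Fin 2 → ℝ) j) y) + EuclideanSpace.single j (L j) := by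
    ext m
    rcases Fin.eq_self_or_eq_succAbove j m with rfl | ⟨m', rfl⟩ <;> simp [hTv]
  simp only [h1, hper j]

theorem laplacian_eq_sum_partialDeriv {f : Plane → ℝ} (hf : ContDiff ℝ 2 f) (x : Plane) :
    (Δ f) x = ∑ i, partialDeriv i (partialDeriv i f) x := by
  rw [InnerProductSpace.laplacian_eq_iteratedFDeriv_orthonormalBasis f
    (EuclideanSpace.basisFun (Fin 2) ℝ)]
  refine Finset.sum_congr rfl fun i _ => ?_
  rw [iteratedFDeriv_two_apply]
  have h : DifferentiableAt ℝ (fderiv ℝ f) x :=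
    ((hf.fderiv_right (m := 1) (by norm_num)).differentiable one_ne_zero) x
  rw [show partialDeriv i f = fun y => fderiv ℝ f y (EuclideanSpace.single i 1) from rfl,
    partialDeriv, fderiv_clm_apply h (differentiableAt_const _)]
  simp

theorem continuous_laplacian {f : Plane → ℝ} (hf : ContDiff ℝ 2 f) : Continuous (Δ f) := by
  rw [show Δ f = fun x => ∑ i, partialDeriv i (partialDeriv i f) x from
    funext (laplacian_eq_sum_partialDeriv hf)]
  refine continuous_finsetSum _ fun i _ => ?_
  exact (contDiff_partialDeriv (m := 0) (contDiff_partialDeriv (m := 1) hf (by norm_num) i)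
    (by simp) i).continuous

/-- The difference of the integrands is the divergence of the periodic field `g ∇f - f ∇g`. -/
theorem integral_laplacian_mul_comm {L : Fin 2 → ℝ} (hL : ∀ i, 0 < L i) {f g : Plane → ℝ}
    (hf : ContDiff ℝ 2 f) (hfp : IsPeriodic L f) (hg : ContDiff ℝ 2 g) (hgp : IsPeriodic L g) :
    ∫ x in cell L, (Δ f) x * g x = ∫ x in cell L, f x * (Δ g) x := by
  have h1 : ∀ i, ContDiff ℝ 1 (partialDeriv i f) := contDiff_partialDeriv hf (by norm_num)
  have h2 : ∀ i, ContDiff ℝ 1 (partialDeriv i g) := contDiff_partialDeriv hg (by norm_num)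
  have hf1 := hf.of_le (m := 1) (by norm_num)
  have hg1 := hg.of_le (m := 1) (by norm_num)
  have hfd := hf1.differentiable one_ne_zero
  have hgd := hg1.differentiable one_ne_zero
  have h0 := integral_sub
    (integrableOn_cell_of_continuous L ((continuous_laplacian hf).mul hg.continuous))
    (integrableOn_cell_of_continuous L (hf.continuous.mul (continuous_laplacian hg)))
  simp only [Pi.mul_apply] at h0
  rw [← sub_eq_zero, ← h0]
  have h3 : ∀ x, (Δ f) x * g x - f x * (Δ g) x =
      ∑ i, (partialDeriv i (fun y => g y * partialDeriv i f y) x -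
        partialDeriv i (fun y => f y * partialDeriv i g y) x) := fun x => by
    rw [laplacian_eq_sum_partialDeriv hf, laplacian_eq_sum_partialDeriv hg, Finset.sum_mul,
      Finset.mul_sum, ← Finset.sum_sub_distrib]
    refine Finset.sum_congr rfl fun i _ => ?_
    rw [partialDeriv_mul hgd ((h1 i).differentiable one_ne_zero),
      partialDeriv_mul hfd ((h2 i).differentiable one_ne_zero)]
    ring
  have hI1 : ∀ i, IntegrableOn (partialDeriv i (fun y => g y * partialDeriv i f y)) (cell L) :=
    fun i => integrableOn_cell_of_continuous L
      (contDiff_partialDeriv (m := 0) (hg1.mul (h1 i)) (by simp) i).continuous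
  have hI2 : ∀ i, IntegrableOn (partialDeriv i (fun y => f y * partialDeriv i g y)) (cell L) :=
    fun i => integrableOn_cell_of_continuous L
      (contDiff_partialDeriv (m := 0) (hf1.mul (h2 i)) (by simp) i).continuous
  simp only [h3]
  refine (integral_finsetSum _ fun i _ => (hI1 i).sub (hI2 i)).trans ?_
  refine Finset.sum_eq_zero fun i _ => ?_
  refine (integral_sub (hI1 i) (hI2 i)).trans ?_
  rw [integral_partialDeriv_eq_zero hL (hg1.mul (h1 i)) (hgp.mul (hfp.partialDeriv i)),
    integral_partialDeriv_eq_zero hL (hf1.mul (h2 i)) (hfp.mul (hgp.partialDeriv i)), sub_zero]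

/-! ### Plane waves -/

/-- The components of the wave vector with index `k`. -/
noncomputable def waveNumber (L : Fin 2 → ℝ) (k : Fin 2 → ℤ) (i : Fin 2) : ℝ := 2 * Real.pi * k i / L i

/-- The plane wave with index `k` and phase shift `c`. -/
noncomputable def wave (L : Fin 2 → ℝ) (k : Fin 2 → ℤ) (c : ℝ) (x : Plane) : ℝ :=
  Real.cos ((∑ i, waveNumber L k i * x i) + c)

/-- The eigenvalues of `-Δ`. -/
noncomputable def eigenvalue (L : Fin 2 → ℝ) (k : Fin 2 → ℤ) : ℝ := ∑ i, waveNumber L k i ^ 2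

theorem contDiff_wave (L : Fin 2 → ℝ) (k : Fin 2 → ℤ) (c : ℝ) {n : WithTop ℕ∞} :
    ContDiff ℝ n (wave L k c) :=
  Real.contDiff_cos.comp <| (ContDiff.sum fun i _ => contDiff_const.mul (by fun_prop)).add
    contDiff_const

theorem abs_wave_le (L : Fin 2 → ℝ) (k : Fin 2 → ℤ) (c : ℝ) (x : Plane) : |wave L k c x| ≤ 1 :=
  Real.abs_cos_le_one _

theorem isPeriodic_wave {L : Fin 2 → ℝ} (hL : ∀ i, 0 < L i) (k : Fin 2 → ℤ) (c : ℝ) :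
    IsPeriodic L (wave L k c) := fun i x => by
  have h : ∑ j, waveNumber L k j * (x + EuclideanSpace.single i (L i)) j =
      (∑ j, waveNumber L k j * x j) + k i * (2 * Real.pi) := by
    simp only [PiLp.add_apply, mul_add, Finset.sum_add_distrib]
    congr 1
    rw [Finset.sum_eq_single i (fun j _ hj => by simp [hj]) (by simp)]
    have := (hL i).ne'
    simp only [waveNumber, PiLp.single_apply, if_true]
    field_simp
  rw [wave, wave, h, add_right_comm, Real.cos_add_int_mul_two_pi]

/-- Since `-sin θ = cos (θ + π/2)`, the free phase closes the family under differentiation up to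
factors. -/
theorem partialDeriv_wave (L : Fin 2 → ℝ) (k : Fin 2 → ℤ) (c : ℝ) (i : Fin 2) (x : Plane) :
    partialDeriv i (wave L k c) x = waveNumber L k i * wave L k (c + Real.pi / 2) x := by
  have h0 : HasFDerivAt (fun x : Plane => (∑ j, waveNumber L k j * x j) + c)
      (∑ j, waveNumber L k j • (EuclideanSpace.proj j : Plane →L[ℝ] ℝ)) x := by
    refine HasFDerivAt.add_const _ (HasFDerivAt.fun_sum fun j _ => ?_)
    exact (EuclideanSpace.proj (𝕜 := ℝ) j).hasFDerivAt.const_mul _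
  rw [partialDeriv, show wave L k c = fun x => Real.cos ((∑ j, waveNumber L k j * x j) + c) from rfl,
    h0.cos.fderiv, wave, ← add_assoc, Real.cos_add_pi_div_two]
  fin_cases i <;> simp [mul_comm]

theorem laplacian_const_mul_wave (L : Fin 2 → ℝ) (k : Fin 2 → ℤ) (a c : ℝ) (x : Plane) :
    (Δ (fun y => a * wave L k c y)) x = -eigenvalue L k * (a * wave L k c x) := by
  have hsm : ∀ (a c : ℝ) (i : Fin 2) (y : Plane), partialDeriv i (fun y => a * wave L k c y) y =
      a * waveNumber L k i * wave L k (c + Real.pi / 2) y := fun a c i y => by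
    have := partialDeriv_wave L k c i y
    simp only [partialDeriv] at this ⊢
    rw [fderiv_const_mul ((contDiff_wave L k c (n := 1)).differentiable one_ne_zero y)]
    simp only [smul_apply, this, smul_eq_mul]
    ring
  rw [laplacian_eq_sum_partialDeriv (contDiff_const.mul (contDiff_wave L k c))]
  have h1 : ∀ i, partialDeriv i (fun y => a * wave L k c y) =
      fun y => (a * waveNumber L k i) * wave L k (c + Real.pi / 2) y := fun i =>
    funext (hsm a c i)
  simp only [h1, hsm, add_assoc, add_halves, eigenvalue]
  have h2 : wave L k (c + Real.pi) x = -wave L k c x := by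
    rw [wave, wave, ← add_assoc, Real.cos_add_pi]
  rw [h2, neg_mul, Finset.sum_mul, ← Finset.sum_neg_distrib]
  exact Finset.sum_congr rfl fun i _ => by ring

theorem waveNumber_eq_zero {L : Fin 2 → ℝ} (hL : ∀ i, 0 < L i) {k : Fin 2 → ℤ} {i : Fin 2} :
    waveNumber L k i = 0 ↔ k i = 0 := by
  simp [waveNumber, (hL i).ne', Real.pi_ne_zero]

/-- A nonconstant wave is, up to a nonzero factor, a derivative of the wave with phase shifted back
by `π/2`. -/
theorem integral_wave {L : Fin 2 → ℝ} (hL : ∀ i, 0 < L i) {k : Fin 2 → ℤ} (hk : k ≠ 0) (c : ℝ) :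
    ∫ x in cell L, wave L k c x = 0 := by
  obtain ⟨i, hi⟩ := Function.ne_iff.1 hk
  have hi' : waveNumber L k i ≠ 0 := fun h => hi ((waveNumber_eq_zero hL).1 h)
  have h := integral_partialDeriv_eq_zero hL (contDiff_wave L k (c - Real.pi / 2))
    (isPeriodic_wave hL k _) i
  simp only [partialDeriv_wave, sub_add_cancel] at h
  rw [integral_const_mul] at h
  exact (mul_eq_zero.1 h).resolve_left hi'

theorem wave_mul_wave (L : Fin 2 → ℝ) (k l : Fin 2 → ℤ) (c d : ℝ) (x : Plane) :
    wave L k c x * wave L l d x =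
      (wave L (k - l) (c - d) x + wave L (k + l) (c + d) x) / 2 := by
  have h1 : (∑ i, waveNumber L (k - l) i * x i) + (c - d) =
      ((∑ i, waveNumber L k i * x i) + c) - ((∑ i, waveNumber L l i * x i) + d) := by
    simp only [Fin.sum_univ_two, waveNumber, Pi.sub_apply, Int.cast_sub]; ring
  have h2 : (∑ i, waveNumber L (k + l) i * x i) + (c + d) =
      ((∑ i, waveNumber L k i * x i) + c) + ((∑ i, waveNumber L l i * x i) + d) := by
    simp only [Fin.sum_univ_two, waveNumber, Pi.add_apply, Int.cast_add]; ring
  simp only [wave]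
  rw [h1, h2, Real.cos_sub, Real.cos_add ((∑ i, waveNumber L k i * x i) + c)]
  ring

/-! ### Completeness of the plane waves, from Fourier series on the unit torus -/

section TorusSection

noncomputable local instance : MeasureSpace UnitAddCircle := ⟨AddCircle.haarAddCircle⟩

local instance : Measure.IsAddHaarMeasure (volume : Measure UnitAddCircle) :=
  inferInstanceAs (Measure.IsAddHaarMeasure AddCircle.haarAddCircle)

local instance : IsProbabilityMeasure (volume : Measure UnitAddCircle) :=
  inferInstanceAs (IsProbabilityMeasure AddCircle.haarAddCircle)

/-- A section of the covering map from the period cell to the unit torus, which preserves the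
measures up to a factor. -/
theorem exists_torus_section {L : Fin 2 → ℝ} (hL : ∀ i, 0 < L i) :
    ∃ (c : ENNReal) (σ : UnitAddTorus (Fin 2) → Plane), c ≠ 0 ∧ c ≠ ⊤ ∧
      MeasurePreserving σ volume (c • (volume : Measure Plane).restrict (cell L)) ∧
      ∀ t i, ((σ t i / L i : ℝ) : UnitAddCircle) = t i := by
  let Ψ : (Fin 2 → ℝ) ≃L[ℝ] Plane :=
    (ContinuousLinearEquiv.piCongrRight fun i => ContinuousLinearEquiv.unitsEquivAut ℝ
      (Units.mk0 (L i) (hL i).ne')).trans (EuclideanSpace.equiv (Fin 2) ℝ).symm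
  have hΨ : ∀ x i, Ψ x i = x i * L i := fun x i => rfl
  have := Ψ.isAddHaarMeasure_map volume
  -- Uniqueness of Haar measure provides the scaling factor. Its value is irrelevant; only `0 < c <
  -- ∞` matters.
  set c := Measure.addHaarScalarFactor (Measure.map Ψ volume) (volume : Measure Plane) with hc
  have hcpos : 0 < c := Measure.addHaarScalarFactor_pos_of_isAddHaarMeasure _ _
  have hmap : MeasurePreserving Ψ volume ((c : ENNReal) • (volume : Measure Plane)) :=
    ⟨Ψ.continuous.measurable,
      Measure.isAddLeftInvariant_eq_smul (Measure.map Ψ volume) (volume : Measure Plane)⟩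
  set box : Set (Fin 2 → ℝ) := {x | ∀ i, x i ∈ Set.Ioc ((0 : Fin 2 → ℝ) i) ((0 : Fin 2 → ℝ) i + 1)}
    with hbox
  have hboxm : MeasurableSet box := by
    have : box = Set.pi Set.univ fun i => Set.Ioc ((0 : Fin 2 → ℝ) i) ((0 : Fin 2 → ℝ) i + 1) := by
      ext; simp [hbox]
    rw [this]
    exact MeasurableSet.univ_pi fun i => measurableSet_Ioc
  have hbox_ae : Ψ ⁻¹' cell L =ᵐ[volume] box := by
    have h1 : Ψ ⁻¹' cell L = Set.pi Set.univ fun i => Set.Ioo ((0 : Fin 2 → ℝ) i) ((1 : Fin 2 → ℝ) i) := by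
      ext x
      simp only [cell, Set.mem_preimage, Set.mem_ofPred_eq, hΨ, Set.mem_Ioo, Set.mem_pi, Set.mem_univ,
        true_imp_iff, Pi.zero_apply, Pi.one_apply]
      refine forall_congr' fun i => ?_
      rw [mul_pos_iff_of_pos_right (hL i), mul_lt_iff_lt_one_left (hL i)]
    have h2 : box = Set.pi Set.univ fun i => Set.Ioc ((0 : Fin 2 → ℝ) i) ((1 : Fin 2 → ℝ) i) := by
      ext; simp [hbox]
    rw [h1, h2]
    exact Measure.univ_pi_Ioo_ae_eq_Icc.trans Measure.univ_pi_Ioc_ae_eq_Icc.symm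
  have hres : MeasurePreserving Ψ (volume.restrict box)
      ((c : ENNReal) • (volume : Measure Plane).restrict (cell L)) := by
    have := hmap.restrict_preimage (isOpen_cell L).measurableSet
    rwa [Measure.restrict_congr_set hbox_ae, Measure.restrict_smul] at this
  refine ⟨c, fun t => Ψ (UnitAddTorus.measurableEquivPiIoc (0 : Fin 2 → ℝ) t).1,
    by simpa using hcpos.ne', ENNReal.coe_ne_top, ?_, fun t i => ?_⟩
  · exact hres.comp ((measurePreserving_subtype_coe hboxm).comp
      (UnitAddTorus.measurePreserving_equivPiIoc (0 : Fin 2 → ℝ)))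
  · rw [hΨ, mul_div_cancel_right₀ _ (hL i).ne', UnitAddTorus.coe_measurableEquivPiIoc_apply]
    exact AddCircle.coe_equivIoc

theorem wave_zero (L : Fin 2 → ℝ) (c : ℝ) (x : Plane) : wave L 0 c x = Real.cos c := by
  simp [wave, waveNumber]

theorem mFourier_div_eq (L : Fin 2 → ℝ) (k : Fin 2 → ℤ) (x : Plane) :
    UnitAddTorus.mFourier k (fun i => ((x i / L i : ℝ) : UnitAddCircle)) =
      wave L k 0 x - wave L k (Real.pi / 2) x * Complex.I := by
  have h : UnitAddTorus.mFourier k (fun i => ((x i / L i : ℝ) : UnitAddCircle)) =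
      Complex.exp (((∑ i, waveNumber L k i * x i : ℝ) : ℂ) * Complex.I) := by
    simp only [UnitAddTorus.mFourier, ContinuousMap.coe_mk, fourier_coe_apply, Fin.prod_univ_two,
      Fin.sum_univ_two, ← Complex.exp_add, waveNumber]
    congr 1
    push_cast
    ring
  rw [h, Complex.exp_mul_I, wave, wave, Real.cos_add_pi_div_two, add_zero]
  push_cast
  ring

/-- A square integrable function which is orthogonal to all plane waves vanishes. -/
theorem eq_zero_of_integral_wave_eq_zero {L : Fin 2 → ℝ} (hL : ∀ i, 0 < L i) (f : L2 L)
    (hf : ∀ k c, ∫ x in cell L, wave L k c x * f x = 0) : f = 0 := by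
  obtain ⟨c, σ, hc0, hct, hσ, hσt⟩ := exists_torus_section hL
  set fC : Plane → ℂ := fun x => ((f x : ℝ) : ℂ) with hfC
  have hmem : MemLp fC 2 ((volume : Measure Plane).restrict (cell L)) := (Lp.memLp f).ofReal
  have hmemc : MemLp fC 2 (c • (volume : Measure Plane).restrict (cell L)) :=
    hmem.smul_measure hct
  have hmemσ : MemLp (fC ∘ σ) 2 (volume : Measure (UnitAddTorus (Fin 2))) :=
    hmemc.comp_measurePreserving hσ
  have hcoeff : ∀ n, UnitAddTorus.mFourierCoeff (fC ∘ σ) n = 0 := fun n => by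
    have hint : ∀ k d, Integrable (fun x => wave L k d x * f x)
        ((volume : Measure Plane).restrict (cell L)) := fun k d =>
      (memLp_cell_of_continuous L (contDiff_wave L k d (n := 0)).continuous 2).integrable_mul
        (Lp.memLp f)
    have h1 : ∀ t, UnitAddTorus.mFourier (-n) t • (fC ∘ σ) t =
        (fun x => ((wave L (-n) 0 x * f x : ℝ) : ℂ) -
          ((wave L (-n) (Real.pi / 2) x * f x : ℝ) : ℂ) * Complex.I) (σ t) := fun t => by
      have h2 : t = fun i => ((σ t i / L i : ℝ) : UnitAddCircle) := funext fun i => (hσt t i).symm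
      conv_lhs => rw [h2, mFourier_div_eq, ← h2]
      simp only [hfC, Function.comp_apply, smul_eq_mul]
      push_cast
      ring
    have h3 : Integrable (fun x => ((wave L (-n) 0 x * f x : ℝ) : ℂ) -
          ((wave L (-n) (Real.pi / 2) x * f x : ℝ) : ℂ) * Complex.I)
        ((volume : Measure Plane).restrict (cell L)) :=
      (hint _ _).ofReal.sub ((hint _ _).ofReal.mul_const _)
    rw [UnitAddTorus.mFourierCoeff]
    simp only [h1]
    have h4 := integral_map hσ.measurable.aemeasurable (μ := volume)
      (f := fun x => ((wave L (-n) 0 x * f x : ℝ) : ℂ) -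
          ((wave L (-n) (Real.pi / 2) x * f x : ℝ) : ℂ) * Complex.I)
      (by rw [hσ.map_eq]; exact (h3.smul_measure hct).aestronglyMeasurable)
    rw [hσ.map_eq] at h4
    refine h4.symm.trans ?_
    rw [integral_smul_measure, integral_sub (hint _ _).ofReal ((hint _ _).ofReal.mul_const _),
      integral_mul_const]
    have h5 : ∀ k d, ∫ x in cell L, ((wave L k d x * f x : ℝ) : ℂ) = 0 := fun k d => by
      rw [integral_complex_ofReal, hf, Complex.ofReal_zero]
    rw [h5, h5]
    simp
  have hzero : hmemσ.toLp = 0 := by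
    apply UnitAddTorus.mFourierBasis.repr.injective
    ext n
    rw [UnitAddTorus.mFourierBasis_repr, map_zero]
    refine Eq.trans ?_ (hcoeff n)
    refine integral_congr_ae ?_
    filter_upwards [hmemσ.coeFn_toLp] with t ht
    rw [ht]
  have hnorm : eLpNorm (fC ∘ σ) 2 (volume : Measure (UnitAddTorus (Fin 2))) = 0 := by
    have := congrArg (fun g => ‖g‖ₑ) hzero
    simpa [Lp.enorm_toLp] using this
  rw [eLpNorm_comp_measurePreserving hmemc.aestronglyMeasurable hσ,
    eLpNorm_eq_zero_iff hmemc.aestronglyMeasurable (by simp)] at hnorm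
  refine Lp.ext ?_
  have h6 : ∀ᵐ x ∂((volume : Measure Plane).restrict (cell L)), fC x = 0 :=
    (Measure.ae_ennreal_smul_measure_iff hc0).1 hnorm
  filter_upwards [h6, Lp.coeFn_zero ℝ 2 ((volume : Measure Plane).restrict (cell L))] with x h7 h8
  rw [h8]
  simpa [hfC] using h7

end TorusSection

/-! ### The Hilbert basis of real plane waves -/

/-- The real plane waves `√(2/|Ω|) cos (ξ · x - π/4)`. -/
noncomputable def mode (L : Fin 2 → ℝ) (k : Fin 2 → ℤ) (x : Plane) : ℝ :=
  Real.sqrt (2 / (volume : Measure Plane).real (cell L)) * wave L k (-(Real.pi / 4)) x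

theorem contDiff_mode (L : Fin 2 → ℝ) (k : Fin 2 → ℤ) {n : WithTop ℕ∞} :
    ContDiff ℝ n (mode L k) :=
  contDiff_const.mul (contDiff_wave L k _)

theorem isTest_mode {L : Fin 2 → ℝ} (hL : ∀ i, 0 < L i) (k : Fin 2 → ℤ) : IsTest L (mode L k) where
  smooth := contDiff_mode L k
  periodic := fun i x => by rw [mode, mode, isPeriodic_wave hL]

theorem laplacian_mode (L : Fin 2 → ℝ) (k : Fin 2 → ℤ) (x : Plane) :
    (Δ (mode L k)) x = -eigenvalue L k * mode L k x :=
  laplacian_const_mul_wave L k _ _ x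

theorem abs_mode_le (L : Fin 2 → ℝ) (k : Fin 2 → ℤ) (x : Plane) :
    |mode L k x| ≤ Real.sqrt (2 / (volume : Measure Plane).real (cell L)) := by
  rw [mode, abs_mul, abs_of_nonneg (Real.sqrt_nonneg _)]
  exact mul_le_of_le_one_right (Real.sqrt_nonneg _) (abs_wave_le L k _ x)

/-- The phase `-π/4` lets one cosine per index replace the sine–cosine pairs: in the product formula
the `k + l` wave has phase `-π/2`, so its integral vanishes even for `l = -k`. The same
normalisation then fits `k = 0`. -/
theorem integral_mode_mul_mode {L : Fin 2 → ℝ} (hL : ∀ i, 0 < L i) (k l : Fin 2 → ℤ) :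
    ∫ x in cell L, mode L k x * mode L l x = if k = l then 1 else 0 := by
  have hV := volume_real_cell_pos hL
  have hint : ∀ k c, IntegrableOn (wave L k c) (cell L) := fun k c =>
    integrableOn_cell_of_continuous L (contDiff_wave L k c (n := 0)).continuous
  have h1 : ∀ x, mode L k x * mode L l x = ((volume : Measure Plane).real (cell L))⁻¹ *
      (wave L (k - l) 0 x + wave L (k + l) (-(Real.pi / 2)) x) := fun x => by
    have h2 := Real.mul_self_sqrt (show 0 ≤ 2 / (volume : Measure Plane).real (cell L) by positivity)
    have h3 := wave_mul_wave L k l (-(Real.pi / 4)) (-(Real.pi / 4)) x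
    rw [sub_self, show -(Real.pi / 4) + -(Real.pi / 4) = -(Real.pi / 2) by ring] at h3
    rw [mode, mode, mul_mul_mul_comm, h2, h3]
    ring
  have h4 : ∫ x in cell L, wave L (k + l) (-(Real.pi / 2)) x = 0 := by
    by_cases h : k + l = 0
    · have : ∀ x, wave L (k + l) (-(Real.pi / 2)) x = 0 := fun x => by
        rw [h, wave_zero, Real.cos_neg, Real.cos_pi_div_two]
      simp [this]
    · exact integral_wave hL h _
  simp only [h1]
  rw [integral_const_mul, integral_add (hint _ _) (hint _ _), h4, add_zero]
  split_ifs with h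
  · have : ∀ x, wave L (k - l) 0 x = 1 := fun x => by
      rw [h, sub_self, wave_zero, Real.cos_zero]
    simp [this, hV.ne']
  · rw [integral_wave hL (sub_ne_zero.2 h), mul_zero]

theorem inner_toLp_eq {L : Fin 2 → ℝ} {g : Plane → ℝ}
    (hg : MemLp g 2 ((volume : Measure Plane).restrict (cell L))) (f : L2 L) :
    inner ℝ hg.toLp f = ∫ x in cell L, g x * f x := by
  rw [L2.inner_def]
  refine integral_congr_ae ?_
  filter_upwards [hg.coeFn_toLp] with x hx
  simp [hx, mul_comm]

theorem memLp_mode (L : Fin 2 → ℝ) (k : Fin 2 → ℤ) :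
    MemLp (mode L k) 2 ((volume : Measure Plane).restrict (cell L)) :=
  memLp_cell_of_continuous L (contDiff_mode L k (n := 0)).continuous 2

theorem orthonormal_mode {L : Fin 2 → ℝ} (hL : ∀ i, 0 < L i) :
    Orthonormal ℝ fun k => (memLp_mode L k).toLp := by
  rw [orthonormal_iff_ite]
  intro k l
  rw [inner_toLp_eq, ← integral_mode_mul_mode hL]
  refine integral_congr_ae ?_
  filter_upwards [(memLp_mode L l).coeFn_toLp] with x hx
  rw [hx]

/-- The real plane waves span a dense subspace of `L²(Ω)`. -/
theorem span_mode_orthogonal {L : Fin 2 → ℝ} (hL : ∀ i, 0 < L i) :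
    (Submodule.span ℝ (Set.range fun k => (memLp_mode L k).toLp))ᗮ = ⊥ := by
  rw [Submodule.eq_bot_iff]
  intro f hf
  have hV := volume_real_cell_pos hL
  have hint : ∀ k d, Integrable (fun x => wave L k d x * f x)
        ((volume : Measure Plane).restrict (cell L)) := fun k d =>
      (memLp_cell_of_continuous L (contDiff_wave L k d (n := 0)).continuous 2).integrable_mul
        (Lp.memLp f)
  have h1 : ∀ k, ∫ x in cell L, wave L k (-(Real.pi / 4)) x * f x = 0 := fun k => by
    have h2 := (Submodule.mem_orthogonal _ _).1 hf _ (Submodule.subset_span ⟨k, rfl⟩)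
    rw [inner_toLp_eq] at h2
    simp only [mode, mul_assoc] at h2
    rw [integral_const_mul] at h2
    exact (mul_eq_zero.1 h2).resolve_left (Real.sqrt_pos.2 (by positivity)).ne'
  -- Evenness of the cosine: the wave with index `k` and phase `π/4` is the one with index `-k` and
  -- phase `-π/4`.
  have h3 : ∀ k, ∫ x in cell L, wave L k (Real.pi / 4) x * f x = 0 := fun k => by
    rw [← h1 (-k)]
    refine integral_congr_ae (Filter.Eventually.of_forall fun x => ?_)
    simp only [wave, waveNumber, Pi.neg_apply, Fin.sum_univ_two, Int.cast_neg]
    rw [← Real.cos_neg]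
    congr 2
    ring
  refine eq_zero_of_integral_wave_eq_zero hL f fun k c => ?_
  -- The phases `±π/4` are a quarter turn apart, so they span all phases.
  have h4 : ∀ x, wave L k c x * f x =
      Real.sin (Real.pi / 4 - c) * (wave L k (-(Real.pi / 4)) x * f x) +
        Real.sin (Real.pi / 4 + c) * (wave L k (Real.pi / 4) x * f x) := fun x => by
    have h5 : Real.sqrt 2 * Real.sqrt 2 = 2 := Real.mul_self_sqrt zero_le_two
    simp only [wave, Real.cos_add, Real.sin_add, Real.sin_sub, Real.cos_neg, Real.sin_neg,
      Real.cos_pi_div_four, Real.sin_pi_div_four]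
    linear_combination (-(Real.cos (∑ i, waveNumber L k i * x i) * Real.cos c -
      Real.sin (∑ i, waveNumber L k i * x i) * Real.sin c) * f x / 2) * h5
  simp only [h4]
  rw [integral_add ((hint _ _).const_mul _) ((hint _ _).const_mul _), integral_const_mul,
    integral_const_mul, h1, h3, mul_zero, mul_zero, add_zero]

/-- The Hilbert basis of `L²(Ω)` that consists of the real plane waves. -/
noncomputable def modeBasis {L : Fin 2 → ℝ} (hL : ∀ i, 0 < L i) :
    HilbertBasis (Fin 2 → ℤ) ℝ (L2 L) :=
  HilbertBasis.mkOfOrthogonalEqBot (orthonormal_mode hL) (span_mode_orthogonal hL)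

theorem coeFn_modeBasis {L : Fin 2 → ℝ} (hL : ∀ i, 0 < L i) (k : Fin 2 → ℤ) :
    ∀ᵐ x ∂((volume : Measure Plane).restrict (cell L)), modeBasis hL k x = mode L k x := by
  rw [modeBasis, HilbertBasis.coe_mkOfOrthogonalEqBot]
  exact (memLp_mode L k).coeFn_toLp

theorem ae_abs_modeBasis_le {L : Fin 2 → ℝ} (hL : ∀ i, 0 < L i) (k : Fin 2 → ℤ) :
    ∀ᵐ x ∂((volume : Measure Plane).restrict (cell L)),
      |modeBasis hL k x| ≤ Real.sqrt (2 / (volume : Measure Plane).real (cell L)) := by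
  filter_upwards [coeFn_modeBasis hL k] with x hx
  rw [hx]
  exact abs_mode_le L k x

theorem inner_modeBasis {L : Fin 2 → ℝ} (hL : ∀ i, 0 < L i) (k : Fin 2 → ℤ) (f : L2 L) :
    inner ℝ (modeBasis hL k) f = ∫ x in cell L, f x * mode L k x := by
  rw [L2.inner_def]
  refine integral_congr_ae ?_
  filter_upwards [coeFn_modeBasis hL k] with x hx
  simp [hx]

/-- The Laplacian acts on the coefficients as multiplication by the eigenvalues. -/
theorem isLaplacian_of_inner {L : Fin 2 → ℝ} (hL : ∀ i, 0 < L i) {v w : L2 L}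
    (h : ∀ k, inner ℝ (modeBasis hL k) w = -eigenvalue L k * inner ℝ (modeBasis hL k) v) :
    IsLaplacian L v w := by
  intro ψ hψ
  have hψ2 : ContDiff ℝ 2 ψ := by exact_mod_cast contDiff_infty.1 hψ.smooth 2
  have hP := memLp_cell_of_continuous L hψ2.continuous 2
  have hD := memLp_cell_of_continuous L (continuous_laplacian hψ2) 2
  have h1 : ∀ {g : Plane → ℝ} (hg : MemLp g 2 ((volume : Measure Plane).restrict (cell L)))
      (u : L2 L), ∫ x in cell L, u x * g x = inner ℝ hg.toLp u := fun hg u => by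
    rw [inner_toLp_eq]
    simp only [mul_comm]
  have h2 : ∀ {g : Plane → ℝ} (hg : MemLp g 2 ((volume : Measure Plane).restrict (cell L))) k,
      inner ℝ hg.toLp (modeBasis hL k) = ∫ x in cell L, g x * mode L k x := fun hg k => by
    rw [inner_toLp_eq]
    refine integral_congr_ae ?_
    filter_upwards [coeFn_modeBasis hL k] with x hx
    rw [hx]
  rw [h1 hD, h1 hP, ← (modeBasis hL).tsum_inner_mul_inner, ← (modeBasis hL).tsum_inner_mul_inner]
  refine tsum_congr fun k => ?_
  rw [h2, h2, integral_laplacian_mul_comm hL hψ2 hψ.periodic (contDiff_mode L k)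
    (isTest_mode hL k).periodic, h]
  simp only [laplacian_mode]
  have h3 : ∀ x, ψ x * (-eigenvalue L k * mode L k x) = -eigenvalue L k * (ψ x * mode L k x) :=
    fun x => by ring
  simp only [h3]
  rw [integral_const_mul]
  ring

/-! ### Eigenvalues, the symbol and its inverse -/

theorem eigenvalue_nonneg (L : Fin 2 → ℝ) (k : Fin 2 → ℤ) : 0 ≤ eigenvalue L k :=
  Finset.sum_nonneg fun _ _ => sq_nonneg _

theorem eigenvalue_zero (L : Fin 2 → ℝ) : eigenvalue L 0 = 0 := by
  simp [eigenvalue, waveNumber]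

theorem sum_le_eigenvalue {L : Fin 2 → ℝ} {k : Fin 2 → ℤ} (i : Fin 2) :
    (2 * Real.pi * k i / L i) ^ 2 ≤ eigenvalue L k :=
  Finset.single_le_sum (f := fun i => waveNumber L k i ^ 2) (fun _ _ => sq_nonneg _)
    (Finset.mem_univ i)

/-- The spectral gap: it makes `(-Δ)⁻¹` bounded on the mean zero modes. -/
theorem exists_le_eigenvalue {L : Fin 2 → ℝ} (hL : ∀ i, 0 < L i) :
    ∃ δ, 0 < δ ∧ ∀ k, k ≠ 0 → δ ≤ eigenvalue L k := by
  refine ⟨min ((2 * Real.pi / L 0) ^ 2) ((2 * Real.pi / L 1) ^ 2), ?_, fun k hk => ?_⟩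
  · have := hL 0
    have := hL 1
    have := Real.pi_pos
    positivity
  · obtain ⟨i, hi⟩ := Function.ne_iff.1 hk
    have h1 : (1 : ℝ) ≤ (k i : ℝ) ^ 2 := by
      have : 1 ≤ k i ^ 2 := sq_pos_of_ne_zero hi
      exact_mod_cast this
    refine le_trans ?_ (sum_le_eigenvalue i)
    have h2 : (2 * Real.pi * k i / L i) ^ 2 = (2 * Real.pi / L i) ^ 2 * (k i : ℝ) ^ 2 := by ring
    have h3 : min ((2 * Real.pi / L 0) ^ 2) ((2 * Real.pi / L 1) ^ 2) ≤ (2 * Real.pi / L i) ^ 2 := by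
      fin_cases i
      · exact min_le_left _ _
      · exact min_le_right _ _
    rw [h2]
    nlinarith [sq_nonneg (2 * Real.pi / L i)]

/-- Each squared wave number is at most the eigenvalue, so `(1 + ξ₀²)(1 + ξ₁²) ≤ (1 + l)²`, and the
double series is dominated by a product of two convergent series over `ℤ`. -/
theorem summable_inv_one_add_eigenvalue_sq {L : Fin 2 → ℝ} (hL : ∀ i, 0 < L i) :
    Summable fun k => ((1 + eigenvalue L k) ^ 2)⁻¹ := by
  have h1 : ∀ i, Summable fun n : ℤ => (1 + (2 * Real.pi * n / L i) ^ 2)⁻¹ := fun i => by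
    have h2 : Summable fun n : ℤ => (L i / (2 * Real.pi)) ^ 2 * (1 / (n : ℝ) ^ 2) :=
      (Real.summable_one_div_int_pow.2 one_lt_two).mul_left _
    refine ((hasSum_ite_eq (0 : ℤ) (1 : ℝ)).summable.add h2).of_nonneg_of_le
      (fun n => by positivity) fun n => ?_
    have hLi := hL i
    by_cases hn : n = 0
    · simp [hn]
    · have hn' : (0 : ℝ) < (n : ℝ) ^ 2 := by positivity
      have hpi := Real.pi_pos
      rw [if_neg hn, zero_add, show (L i / (2 * Real.pi)) ^ 2 * (1 / (n : ℝ) ^ 2) =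
        ((2 * Real.pi * n / L i) ^ 2)⁻¹ by field_simp]
      exact inv_anti₀ (by positivity) (by linarith)
  have h3 := ((h1 0).mul_of_nonneg (h1 1) (fun n => by positivity) fun n => by positivity)
  have h4 := (finTwoArrowEquiv ℤ).summable_iff.2 h3
  refine h4.of_nonneg_of_le (fun k => by positivity) fun k => ?_
  simp only [Function.comp_apply, finTwoArrowEquiv_apply]
  rw [← mul_inv]
  refine inv_anti₀ (by positivity) ?_
  have h5 := sum_le_eigenvalue (L := L) (k := k) 0
  have h6 := sum_le_eigenvalue (L := L) (k := k) 1
  have h7 := eigenvalue_nonneg L k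
  rw [sq (1 + eigenvalue L k)]
  exact mul_le_mul (add_le_add le_rfl h5) (add_le_add le_rfl h6) (by positivity) (by positivity)

/-- Under the time step restriction the symbol of the linear part is coercive. -/
theorem le_symbol {a ε l : ℝ} (hε0 : 0 < ε) (hε1 : ε < 1) (ha : 3 / 2 * ε ≤ a) (hl : 0 < l) :
    3 / 1000 * ε * (1 + l) ^ 2 ≤ a / l + (1 - l) ^ 2 - ε := by
  have h0 : 3 / 2 * ε / l ≤ a / l := by gcongr
  rcases le_total l 4 with h4 | h4
  -- For `l ≤ 4` one has `(1 + l)² ≤ 25`, and `3/40 = 25 · 3/1000`.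
  · have h1 : 3 / 40 * ε ≤ 3 / 2 * ε / l + (1 - l) ^ 2 - ε := by
      have h2 : 3 / 2 * ε / l + (1 - l) ^ 2 - ε - 3 / 40 * ε =
          (3 / 2 * ε + l * (1 - l) ^ 2 - ε * l - 3 / 40 * ε * l) / l := by
        field_simp
      have h3 : 0 ≤ 3 / 2 * ε + l * (1 - l) ^ 2 - ε * l - 3 / 40 * ε * l := by
        have h5 : ε * (l * (1 - l) ^ 2) ≤ l * (1 - l) ^ 2 :=
          mul_le_of_le_one_left (by positivity) hε1.le
        -- This is where `3/2` enters: `l³ - 2l² + 3/2` has minimum `3/2 - 32/27 > 0` at `l = 4/3`,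
        -- which leaves room for the term `3/40 * l`.
        have h6 : 0 ≤ 3 / 2 + l * (1 - l) ^ 2 - l - 3 / 40 * l := by
          nlinarith [mul_nonneg hl.le (sq_nonneg (l - 4 / 3)), sq_nonneg (l - 4 / 3)]
        nlinarith
      have := div_nonneg h3 hl.le
      linarith
    have h7 : (1 + l) ^ 2 ≤ 25 := by nlinarith
    nlinarith
  · have h1 : 0 < a / l := div_pos (by linarith) hl
    have h2 : 3 / 1000 * ε * (1 + l) ^ 2 ≤ 3 / 1000 * (1 + l) ^ 2 := by
      have := sq_nonneg (1 + l)
      nlinarith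
    nlinarith

/-- The solution multiplier of the linear part on the mean zero modes. -/
noncomputable def solutionMultiplier (L : Fin 2 → ℝ) (a ε : ℝ) (k : Fin 2 → ℤ) : ℝ :=
  if k = 0 then 0 else (a / eigenvalue L k + (1 - eigenvalue L k) ^ 2 - ε)⁻¹

section Multiplier

variable {L : Fin 2 → ℝ} {a ε : ℝ}

theorem symbol_pos (hL : ∀ i, 0 < L i) (hε0 : 0 < ε) (hε1 : ε < 1) (ha : 3 / 2 * ε ≤ a)
    {k : Fin 2 → ℤ} (hk : k ≠ 0) :
    0 < eigenvalue L k ∧ 0 < a / eigenvalue L k + (1 - eigenvalue L k) ^ 2 - ε := by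
  obtain ⟨δ, hδ, h⟩ := exists_le_eigenvalue hL
  have hl := hδ.trans_le (h k hk)
  exact ⟨hl, (by positivity : 0 < 3 / 1000 * ε * (1 + eigenvalue L k) ^ 2).trans_le
    (le_symbol hε0 hε1 ha hl)⟩

theorem solutionMultiplier_nonneg (hL : ∀ i, 0 < L i) (hε0 : 0 < ε) (hε1 : ε < 1)
    (ha : 3 / 2 * ε ≤ a) (k : Fin 2 → ℤ) : 0 ≤ solutionMultiplier L a ε k := by
  rw [solutionMultiplier]
  split_ifs with hk
  · exact le_rfl
  · exact (inv_pos.2 (symbol_pos hL hε0 hε1 ha hk).2).le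

theorem solutionMultiplier_le (hL : ∀ i, 0 < L i) (hε0 : 0 < ε) (hε1 : ε < 1)
    (ha : 3 / 2 * ε ≤ a) (k : Fin 2 → ℤ) :
    solutionMultiplier L a ε k ≤ (3 / 1000 * ε)⁻¹ * ((1 + eigenvalue L k) ^ 2)⁻¹ := by
  have hl0 := eigenvalue_nonneg L k
  rw [solutionMultiplier]
  split_ifs with hk
  · positivity
  · rw [← mul_inv]
    exact inv_anti₀ (by positivity) (le_symbol hε0 hε1 ha (symbol_pos hL hε0 hε1 ha hk).1)

theorem summable_solutionMultiplier (hL : ∀ i, 0 < L i) (hε0 : 0 < ε) (hε1 : ε < 1)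
    (ha : 3 / 2 * ε ≤ a) : Summable (solutionMultiplier L a ε) :=
  ((summable_inv_one_add_eigenvalue_sq hL).mul_left _).of_nonneg_of_le
    (solutionMultiplier_nonneg hL hε0 hε1 ha) (solutionMultiplier_le hL hε0 hε1 ha)

/-- `S` gains four derivatives. With `p l = 1 - l` and `p l = (1 - l)²` this yields the `L²`
functions `(1 + Δ) z` and `(1 + Δ)² z`. -/
theorem abs_mul_solutionMultiplier_le (hL : ∀ i, 0 < L i) (hε0 : 0 < ε) (hε1 : ε < 1)
    (ha : 3 / 2 * ε ≤ a) {p : ℝ → ℝ} (hp : ∀ l, 0 ≤ l → |p l| ≤ (1 + l) ^ 2) (k : Fin 2 → ℤ) :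
    |p (eigenvalue L k) * solutionMultiplier L a ε k| ≤ (3 / 1000 * ε)⁻¹ := by
  have hl0 := eigenvalue_nonneg L k
  rw [abs_mul, abs_of_nonneg (solutionMultiplier_nonneg hL hε0 hε1 ha k)]
  refine (mul_le_mul (hp _ hl0) (solutionMultiplier_le hL hε0 hε1 ha k)
    (solutionMultiplier_nonneg hL hε0 hε1 ha k) (by positivity)).trans_eq ?_
  have : (1 + eigenvalue L k) ^ 2 ≠ 0 := by positivity
  field_simp

/-- The equation for one coefficient, solved for the linear part. -/
theorem coefficient_equation_iff (hL : ∀ i, 0 < L i) (hε0 : 0 < ε) (hε1 : ε < 1)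
    (ha : 3 / 2 * ε ≤ a) (k : Fin 2 → ℤ) (z q c : ℝ) :
    a * z + q = -eigenvalue L k * ((1 - eigenvalue L k) ^ 2 * z + c - ε * z) ↔
      z = (if k = 0 then -a⁻¹ else 0) * q + solutionMultiplier L a ε k *
        ((if k = 0 then 0 else -(eigenvalue L k)⁻¹) * q - c) := by
  by_cases hk : k = 0
  · have ha0 : a ≠ 0 := by linarith [ha, hε0]
    simp only [solutionMultiplier, hk, eigenvalue_zero, if_true]
    field_simp
    constructor <;> intro h <;> linarith
  · obtain ⟨hl, hm⟩ := symbol_pos hL hε0 hε1 ha hk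
    simp only [solutionMultiplier, hk, if_false, zero_mul, zero_add]
    rw [← div_eq_inv_mul, eq_div_iff hm.ne']
    have hl' := hl.ne'
    field_simp
    constructor <;> intro h <;> linarith

end Multiplier

/-! ### The equation at one time level -/

variable {L : Fin 2 → ℝ} {ε τ : ℝ} {k : ℕ}

theorem bdf_congr {V : Type*} [AddCommGroup V] [Module ℝ V] {φ χ : ℕ → V} {n : ℕ}
    (h : ∀ j ≤ n, φ j = χ j) : bdf k τ φ n = bdf k τ χ n := by
  rw [bdf, bdf]
  congr 1
  refine Finset.sum_congr rfl fun j hj => ?_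
  have hj' := (Finset.mem_Icc.1 hj).2
  rw [h j hj', h (j - 1) (by omega)]

/-- The value at level `n` enters only through the term `j = n`, with weight `b₀/τ`; everything else
is known data. -/
theorem bdf_update {V : Type*} [AddCommGroup V] [Module ℝ V] (φ : ℕ → V) {n : ℕ} (hn : 1 ≤ n)
    (z : V) : bdf k τ (Function.update φ n z) n =
      (bdfKernel k 0 / τ) • z + bdf k τ (Function.update φ n 0) n := by
  obtain ⟨m, rfl⟩ : ∃ m, n = m + 1 := ⟨n - 1, by omega⟩
  have h : ∀ u : V, ∑ j ∈ Finset.Icc 1 m, bdfKernel k (m + 1 - j) •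
      (Function.update φ (m + 1) u j - Function.update φ (m + 1) u (j - 1)) =
      ∑ j ∈ Finset.Icc 1 m, bdfKernel k (m + 1 - j) • (φ j - φ (j - 1)) := fun u => by
    refine Finset.sum_congr rfl fun j hj => ?_
    have hj' := (Finset.mem_Icc.1 hj).2
    rw [Function.update_of_ne (by omega), Function.update_of_ne (by omega)]
  simp only [bdf]
  rw [Finset.sum_Icc_succ_top (by omega), Finset.sum_Icc_succ_top (by omega), h, h]
  simp only [Function.update_self, Nat.sub_self, Nat.add_sub_cancel,
    Function.update_of_ne (show m ≠ m + 1 by omega)]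
  module

theorem SolvesAt.congr {φ χ : ℕ → L2 L} {n : ℕ} (h : ∀ j ≤ n, φ j = χ j)
    (hφ : SolvesAt L ε k τ φ n) : SolvesAt L ε k τ χ n := by
  rwa [SolvesAt, h n le_rfl, bdf_congr h] at hφ

theorem SolvesWeaklyAt.congr {φ χ : ℕ → L2 L} {n : ℕ} (h : ∀ j ≤ n, φ j = χ j)
    (hφ : SolvesWeaklyAt L ε k τ φ n) : SolvesWeaklyAt L ε k τ χ n := by
  rwa [SolvesWeaklyAt, h n le_rfl, bdf_congr h] at hφ

theorem laplacian_const_mul_mode (L : Fin 2 → ℝ) (m : Fin 2 → ℤ) (r : ℝ) :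
    Δ (fun x => r * mode L m x) = fun x => (-eigenvalue L m * r) * mode L m x := by
  funext x
  have h : (fun x => r * mode L m x) = fun x =>
      (r * Real.sqrt (2 / (volume : Measure Plane).real (cell L))) *
        wave L m (-(Real.pi / 4)) x := funext fun x => (mul_assoc _ _ _).symm
  rw [h, laplacian_const_mul_wave, mode]
  ring

/-- The weak form of the scheme, tested with the real plane waves. -/
theorem SolvesWeaklyAt.inner_eq (hL : ∀ i, 0 < L i) {φ : ℕ → L2 L} {n : ℕ}
    (h : SolvesWeaklyAt L ε k τ φ n) (m : Fin 2 → ℤ) :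
    inner ℝ (modeBasis hL m) (bdf k τ φ n) = -eigenvalue L m *
      ((1 - eigenvalue L m) ^ 2 * inner ℝ (modeBasis hL m) (φ n) +
        (∫ x in cell L, φ n x ^ 3 * mode L m x) - ε * inner ℝ (modeBasis hL m) (φ n)) := by
  have h1 : Δ (mode L m) = fun x => -eigenvalue L m * mode L m x := funext (laplacian_mode L m)
  have hφm : Integrable (fun x => φ n x * mode L m x)
      ((volume : Measure Plane).restrict (cell L)) :=
    (Lp.memLp (φ n)).integrable_mul (memLp_mode L m)
  have hcm : Integrable (fun x => φ n x ^ 3 * mode L m x)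
      ((volume : Measure Plane).restrict (cell L)) :=
    h.1.mul_bdd (c := Real.sqrt (2 / (volume : Measure Plane).real (cell L)))
      (contDiff_mode L m (n := 0)).continuous.aestronglyMeasurable
      (Filter.Eventually.of_forall fun x => abs_mode_le L m x)
  have key := h.2 (mode L m) (isTest_mode hL m)
  rw [← inner_modeBasis hL, h1, laplacian_const_mul_mode, laplacian_const_mul_mode] at key
  rw [key]
  have h2 : ∀ x, φ n x * (-eigenvalue L m * mode L m x +
      2 * (-eigenvalue L m * -eigenvalue L m * mode L m x) +
      -eigenvalue L m * (-eigenvalue L m * -eigenvalue L m) * mode L m x) =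
      (-eigenvalue L m * (1 - eigenvalue L m) ^ 2) * (φ n x * mode L m x) := fun x => by ring
  have h3 : ∀ x, (φ n x ^ 3 - ε * φ n x) * (-eigenvalue L m * mode L m x) =
      -eigenvalue L m * (φ n x ^ 3 * mode L m x - ε * (φ n x * mode L m x)) := fun x => by ring
  simp only [h2, h3]
  rw [integral_const_mul, integral_const_mul, integral_sub hcm (hφm.const_mul ε),
    integral_const_mul, inner_modeBasis]
  ring

/-- Unique solvability of the scheme at one time level. -/
theorem existsUnique_level (hL : ∀ i, 0 < L i) (hε0 : 0 < ε) (hε1 : ε < 1) (hτ0 : 0 < τ)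
    (hτ : τ ≤ 2 / (3 * ε) * bdfKernel k 0) {n : ℕ} (hn : 1 ≤ n) (φ : ℕ → L2 L) :
    ∃ z : L2 L, SolvesAt L ε k τ (Function.update φ n z) n ∧
      ∀ z' : L2 L, SolvesWeaklyAt L ε k τ (Function.update φ n z') n → z' = z := by
  set a : ℝ := bdfKernel k 0 / τ with ha
  have ha' : 3 / 2 * ε ≤ a := by
    rw [ha, le_div_iff₀ hτ0]
    calc 3 / 2 * ε * τ ≤ 3 / 2 * ε * (2 / (3 * ε) * bdfKernel k 0) := by gcongr
      _ = bdfKernel k 0 := by field_simp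
  set q : L2 L := bdf k τ (Function.update φ n 0) n with hq
  have hbdf : ∀ z, bdf k τ (Function.update φ n z) n = a • z + q := bdf_update φ hn
  set b := modeBasis hL with hb
  set s := solutionMultiplier L a ε with hs
  have hs0 := solutionMultiplier_nonneg hL hε0 hε1 ha'
  have hsum := summable_solutionMultiplier hL hε0 hε1 ha'
  obtain ⟨δ, hδ, hδle⟩ := exists_le_eigenvalue hL
  -- `z₀` is the mean part forced by the zero mode, and `h` below is `Δ⁻¹ q` on the other modes.
  obtain ⟨z₀, hz₀⟩ := b.exists_multiplier (fun m => if m = 0 then -a⁻¹ else 0) |a⁻¹|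
    (fun m => by split_ifs <;> simp) q
  obtain ⟨h, hh⟩ := b.exists_multiplier (fun m => if m = 0 then 0 else -(eigenvalue L m)⁻¹) δ⁻¹
    (fun m => by
      split_ifs with hm
      · simpa using hδ.le
      · rw [abs_neg, abs_inv, abs_of_nonneg (eigenvalue_nonneg L m)]
        exact inv_anti₀ hδ (hδle m hm)) q
  have hz₀sum : Summable fun m => |inner ℝ (b m) z₀| :=
    summable_of_ne_finset_zero (s := {0}) fun m hm => by
      rw [Finset.mem_singleton] at hm
      simp [hz₀, hm]
  have hiff := coefficient_equation_iff hL hε0 hε1 ha'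
  obtain ⟨z, c, hc, hz⟩ := b.exists_cubic_solution (Real.sqrt_nonneg _)
    (ae_abs_modeBasis_le hL) hs0 hsum z₀ h hz₀sum
  refine ⟨z, ?_, fun z' hz' => ?_⟩
  -- `p(-Δ) z` in `L²`. The condition `p 0 = 1` is needed because the mean part `z₀` is added
  -- unchanged.
  · have hfactor : ∀ p : ℝ → ℝ, p 0 = 1 → (∀ l, 0 ≤ l → |p l| ≤ (1 + l) ^ 2) →
        ∃ u : L2 L, ∀ m, inner ℝ (b m) u = p (eigenvalue L m) * inner ℝ (b m) z := by
      intro p hp0 hp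
      obtain ⟨u, hu⟩ := b.exists_multiplier (fun m => p (eigenvalue L m) * s m) _
        (abs_mul_solutionMultiplier_le hL hε0 hε1 ha' hp) (h - c)
      refine ⟨z₀ + u, fun m => ?_⟩
      rw [inner_add_right, hu, hz m, inner_sub_right, hz₀]
      by_cases hm : m = 0
      · simp only [hm, eigenvalue_zero, hp0]
        ring
      · simp only [hm, if_false]
        ring
    obtain ⟨v, hv⟩ := hfactor (fun l => 1 - l) (by simp) fun l hl =>
      abs_le.2 ⟨by nlinarith, by nlinarith⟩
    obtain ⟨w, hw⟩ := hfactor (fun l => (1 - l) ^ 2) (by simp) fun l hl =>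
      abs_le.2 ⟨by nlinarith, by nlinarith⟩
    refine ⟨w + c - ε • z, ⟨v, w, c, ?_, ?_, ?_, ?_⟩, ?_⟩
    · refine isLaplacian_of_inner hL fun m => ?_
      rw [Function.update_self, inner_sub_right, hv]
      ring
    · refine isLaplacian_of_inner hL fun m => ?_
      rw [inner_sub_right, hv, hw]
      ring
    · rwa [Function.update_self]
    · rw [Function.update_self]
    · refine isLaplacian_of_inner hL fun m => ?_
      rw [hbdf, inner_add_right, real_inner_smul_right, inner_sub_right, inner_add_right,
        real_inner_smul_right, hw]
      refine (hiff m _ _ _).2 ?_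
      rw [← hz₀, ← hh]
      exact hz m
  · have hmode : ∀ (u : L2 L) m, ∫ x in cell L, u x ^ 3 * b m x =
        ∫ x in cell L, u x ^ 3 * mode L m x := fun u m => by
      refine integral_congr_ae ?_
      filter_upwards [coeFn_modeBasis hL m] with x hx
      rw [hx]
    have hcint : Integrable (fun x => z x ^ 3) ((volume : Measure Plane).restrict (cell L)) :=
      ((Lp.memLp c).integrable one_le_two).congr hc
    have hcm : ∀ m, ∫ x in cell L, z x ^ 3 * b m x = inner ℝ (b m) c := fun m => by
      rw [hmode, inner_modeBasis]
      refine integral_congr_ae ?_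
      filter_upwards [hc] with x hx
      rw [hx]
    have hint' := hz'.1
    rw [Function.update_self] at hint'
    refine b.cubic_solution_unique (h := h) (ae_abs_modeBasis_le hL) hs0 hsum hz₀sum hint' (fun m => ?_)
      hcint fun m => ?_
    · have h1 := hz'.inner_eq hL m
      rw [hbdf, inner_add_right, real_inner_smul_right, Function.update_self] at h1
      have h2 := (hiff m _ _ _).1 h1
      rw [← hz₀, ← hh] at h2
      rw [hmode]
      exact h2
    · rw [hcm]
      exact hz m

/-! ### From one level to the whole scheme -/

/-- Unique solvability at each level yields unique solvability of the whole scheme. -/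
theorem existsUnique_scheme {N : ℕ}
    (hlevel : ∀ n : ℕ, k ≤ n → n ≤ N → ∀ φ : ℕ → L2 L,
      ∃ z : L2 L, SolvesAt L ε k τ (Function.update φ n z) n ∧
        ∀ z' : L2 L, SolvesWeaklyAt L ε k τ (Function.update φ n z') n → z' = z)
    (φ₀ : ℕ → L2 L) :
    ∃ φ : ℕ → L2 L, (∀ n, n < k → φ n = φ₀ n) ∧
      (∀ n, k ≤ n → n ≤ N → SolvesAt L ε k τ φ n) ∧
      ∀ φ' : ℕ → L2 L, (∀ n, n < k → φ' n = φ₀ n) →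
        (∀ n, k ≤ n → n ≤ N → SolvesWeaklyAt L ε k τ φ' n) → ∀ n, n ≤ N → φ' n = φ n := by
  -- The induction carries the uniqueness clause at each level already built; later updates leave
  -- the history of that level unchanged.
  have hex : ∀ M, ∃ φ : ℕ → L2 L, (∀ n, n < k → φ n = φ₀ n) ∧
      ∀ n, k ≤ n → n ≤ N → n < M → SolvesAt L ε k τ φ n ∧
        ∀ z', SolvesWeaklyAt L ε k τ (Function.update φ n z') n → z' = φ n := by
    intro M
    induction M with
    | zero => exact ⟨φ₀, fun _ _ => rfl, fun n _ _ h => absurd h (Nat.not_lt_zero n)⟩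
    | succ M ih =>
      obtain ⟨φ, h1, h2⟩ := ih
      by_cases hM : k ≤ M ∧ M ≤ N
      · obtain ⟨z, hz, hzu⟩ := hlevel M hM.1 hM.2 φ
        refine ⟨Function.update φ M z, fun n hn => ?_, fun n hkn hnN hnM => ?_⟩
        · rw [Function.update_of_ne (by omega), h1 n hn]
        · rcases Nat.lt_succ_iff_lt_or_eq.1 hnM with hlt | rfl
          · have hagree : ∀ j ≤ n, φ j = Function.update φ M z j := fun j hj => by
              rw [Function.update_of_ne (by omega)]
            obtain ⟨h3, h4⟩ := h2 n hkn hnN hlt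
            refine ⟨h3.congr hagree, fun z' hz' => ?_⟩
            rw [← hagree n le_rfl]
            refine h4 z' (hz'.congr fun j hj => ?_)
            rcases eq_or_ne j n with rfl | hne
            · simp
            · rw [Function.update_of_ne hne, Function.update_of_ne hne, hagree j hj]
          · refine ⟨hz, fun z' hz' => ?_⟩
            rw [Function.update_idem] at hz'
            rw [Function.update_self, hzu z' hz']
      · refine ⟨φ, h1, fun n hkn hnN hnM => h2 n hkn hnN ?_⟩
        rcases Nat.lt_succ_iff_lt_or_eq.1 hnM with hlt | rfl
        · exact hlt
        · exact absurd ⟨hkn, hnN⟩ hM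
  obtain ⟨φ, h1, h2⟩ := hex (N + 1)
  refine ⟨φ, h1, fun n hkn hnN => (h2 n hkn hnN (by omega)).1, fun φ' h1' h2' n => ?_⟩
  induction n using Nat.strong_induction_on with
  | _ n ih =>
    intro hnN
    rcases lt_or_ge n k with hnk | hkn
    · rw [h1 n hnk, h1' n hnk]
    -- By induction `φ'` has the same history as `φ` below `n`, so it is `φ` updated at `n`, and
    -- uniqueness at that level applies.
    · refine (h2 n hkn hnN (by omega)).2 _ ((h2' n hkn hnN).congr fun j hj => ?_)
      rcases eq_or_ne j n with rfl | hne
      · simp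
      · rw [Function.update_of_ne hne, ih j (by omega) (by omega)]

end PFC

theorem mainTheorem4
    (L : Fin 2 → ℝ) (hL : ∀ i, 0 < L i)
    (ε : ℝ) (hε0 : 0 < ε) (hε1 : ε < 1)
    (k : ℕ) (hk3 : 3 ≤ k) (hk6 : k ≤ 6)
    (τ : ℝ) (hτ0 : 0 < τ) (hτ : τ ≤ 2 / (3 * ε) * PFC.bdfKernel k 0)
    (N : ℕ) :
    -- each time level: the previous values, whatever they are, determine the next one
    (∀ n : ℕ, k ≤ n → n ≤ N → ∀ φ : ℕ → PFC.L2 L,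
      ∃ z : PFC.L2 L, PFC.SolvesAt L ε k τ (Function.update φ n z) n ∧
        ∀ z' : PFC.L2 L, PFC.SolvesWeaklyAt L ε k τ (Function.update φ n z') n → z' = z) ∧
    -- the whole scheme: the starting values determine the solution
    (∀ φ₀ : ℕ → PFC.L2 L,
      ∃ φ : ℕ → PFC.L2 L, (∀ n, n < k → φ n = φ₀ n) ∧
        (∀ n, k ≤ n → n ≤ N → PFC.SolvesAt L ε k τ φ n) ∧
        ∀ φ' : ℕ → PFC.L2 L, (∀ n, n < k → φ' n = φ₀ n) →
          (∀ n, k ≤ n → n ≤ N → PFC.SolvesWeaklyAt L ε k τ φ' n) →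
          ∀ n, n ≤ N → φ' n = φ n) := by
  have hlevel : ∀ n : ℕ, k ≤ n → n ≤ N → ∀ φ : ℕ → PFC.L2 L,
      ∃ z : PFC.L2 L, PFC.SolvesAt L ε k τ (Function.update φ n z) n ∧
        ∀ z' : PFC.L2 L, PFC.SolvesWeaklyAt L ε k τ (Function.update φ n z') n → z' = z :=
    fun n hkn _ φ => PFC.existsUnique_level hL hε0 hε1 hτ0 hτ (by omega) φ
  exact ⟨hlevel, PFC.existsUnique_scheme hlevel⟩
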